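/- Let $\mathcal F$ be the class of functions $f:\mathbb R^2\to\mathbb R$ such that (i) there are $C,\eta>0$ with $$|f(x)|+|\hat f(x)|\le \frac{C}{(1+|x|)^{2+\eta}}\quad\text{for all }x\in\mathbb R^2,\qquad \hat f(p)=\int_{\mathbb R^2}f(x)e^{-2\pi i p\cdot x}\,dx,$$ and (ii) there is a nonnegative Radon measure $\mu_f$ on $(0,\infty)$ with $f(x)=\int_0^\infty e^{-|x|^2t}\,d\mu_f(t)$ (a convergent integral) for all $x\in\mathbb R^2$. For $x\in\mathbb R$ and $y>0$ let $L(x,y)=\mathbb Z\big(\tfrac1{\sqrt y},0\big)\oplus\mathbb Z\big(\tfrac{x}{\sqrt y},\sqrt y\big)$. Let $D=\{(x,y)\in[0,\tfrac12]\times(0,\infty):x^2+y^2\ge1\}$, and let $\mathcal D=\{L(x,y):(x,y)\in D\}$ be the space of two-dimensional lattices of unit density up to isometry; the coordinates $(x,y)\in D$ of a lattice in $\mathcal D$ are unique. For $L_i=L(x_i,y_i)\in\mathcal D$ with $(x_i,y_i)\in D$ put $$d(L_1,L_2)=\sqrt{\inf_{k\in\mathbb Z}\big|x_1-x_2-\tfrac12k\big|^2+|y_1-y_2|^2}.$$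 Let $\Lambda=\sqrt{\tfrac{2}{\sqrt3}}\,\big[\mathbb Z(1,0)\oplus\mathbb Z(\tfrac12,\tfrac{\sqrt3}2)\big]=L\big(\tfrac12,\tfrac{\sqrt3}2\big)\in\mathcal D$ be the triangular lattice, and for a lattice $L$ let $E_f[L]=\sum_{p\in L\setminus\{0\}}f(p)$. **Proposition (local optimality of $\Lambda$ for $E_f$).** Let $f\in\mathcal F$, $f\not\equiv0$. Then the series defining $E_f[L(x,y)]$ converges absolutely for all $x\in\mathbb R$, $y>0$, and $\Lambda$ is a strict local minimizer of $E_f$ in $\mathcal D$ with positive definite Hessian. That is: there is $\eta>0$ such that $E_f[\Lambda]<E_f[L]$ for all $L\in\mathcal D$ with $L\neq\Lambda$ and $d(\Lambda,L)<\eta$; moreover, the function $(x,y)\mapsto E_f[L(x,y)]$ on $\mathbb R\times(0,\infty)$ is of class $C^2$ near $(\tfrac12,\tfrac{\sqrt3}2)$, and its matrix of second derivatives with respect to $(x,y)$ at that point is positive definite. -/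

import Mathlib

open Real MeasureTheory
open scoped FourierTransform ENNReal

/-- The Euclidean plane. -/
abbrev Plane : Type := EuclideanSpace ℝ (Fin 2)

/-- The class of interaction potentials: `f : ℝ² → ℝ` such that
`|f(x)| + |f̂(x)| ≤ C / (1 + |x|)^(2 + η)` for some `C, η > 0`, and `f` is the (everywhere
convergent) Laplace transform, in the variable `|x|²`, of a nonnegative Radon measure on `(0, ∞)`.
The Fourier transform is `f̂(p) = ∫ f(x) exp(-2πi p·x) dx`. (A locally finite Borel measure on the
open half line is automatically Radon.) -/
def PotentialClass : Set (Plane → ℝ) :=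
  {f | (∃ C > 0, ∃ η > 0, ∀ x : Plane,
          |f x| + ‖𝓕 (fun v : Plane => (f v : ℂ)) x‖ ≤ C / (1 + ‖x‖) ^ (2 + η : ℝ)) ∧
       ∃ μ : Measure (Set.Ioi (0 : ℝ)), IsLocallyFiniteMeasure μ ∧ ∀ x : Plane,
          Integrable (fun t : Set.Ioi (0 : ℝ) => Real.exp (-(‖x‖ ^ 2 * (t : ℝ)))) μ ∧
          f x = ∫ t : Set.Ioi (0 : ℝ), Real.exp (-(‖x‖ ^ 2 * (t : ℝ))) ∂μ}

/-- The lattice `ℤ (1/√y, 0) ⊕ ℤ (x/√y, √y)`, for `z = (x, y)` with `y > 0`; it has unit density. -/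
noncomputable def latticeOf (z : ℝ × ℝ) : Submodule ℤ Plane :=
  Submodule.span ℤ {!₂[1 / √z.2, 0], !₂[z.1 / √z.2, √z.2]}

/-- The fundamental domain `D = {(x, y) ∈ [0, 1/2] × (0, ∞) : x² + y² ≥ 1}`. -/
def fundDomain : Set (ℝ × ℝ) :=
  {z | z.1 ∈ Set.Icc (0 : ℝ) (1 / 2) ∧ 0 < z.2 ∧ 1 ≤ z.1 ^ 2 + z.2 ^ 2}

/-- The space of unit density lattices (up to isometry): the lattices `L(x, y)`, `(x, y) ∈ D`. -/
def UnitLattices : Set (Submodule ℤ Plane) := latticeOf '' fundDomain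

/-- The distance of two lattices in terms of their coordinates:
`√(inf_{k ∈ ℤ} |x₁ - x₂ - k/2|² + |y₁ - y₂|²)`. -/
noncomputable def coordDist (z w : ℝ × ℝ) : ℝ :=
  √(⨅ k : ℤ, (|z.1 - w.1 - 1 / 2 * (k : ℝ)| ^ 2 + |z.2 - w.2| ^ 2))

/-- The open ball of radius `R` around the lattice `L` in the space of unit density lattices
(the coordinates in `D` of a lattice are unique). -/
def latticeBall (L : Submodule ℤ Plane) (R : ℝ) : Set (Submodule ℤ Plane) :=
  {M | ∃ z ∈ fundDomain, ∃ w ∈ fundDomain, latticeOf z = L ∧ latticeOf w = M ∧ coordDist z w < R}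

/-- `L` is a strict local minimizer of `E` in the space of unit density lattices. -/
def IsStrictLocalMinimizer (E : Submodule ℤ Plane → ℝ) (L : Submodule ℤ Plane) : Prop :=
  L ∈ UnitLattices ∧ ∃ η > 0, ∀ M ∈ latticeBall L η, M ≠ L → E L < E M

/-- The point-mass energy `E_h[L] = ∑_{p ∈ L \ {0}} h(p)`. -/
noncomputable def pointEnergy (h : Plane → ℝ) (L : Submodule ℤ Plane) : ℝ :=
  ∑' p : ((L : Set Plane) \ {0} : Set Plane), h p

/-- A lattice functional `E` as a function of the coordinates `(x, y)`. -/
noncomputable def inCoords (E : Submodule ℤ Plane → ℝ) : ℝ × ℝ → ℝ := fun z => E (latticeOf z)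

/-- The Hessian: the matrix of second partial derivatives with respect to `x` and `y`
of the lattice functional `E`, at the coordinates `z`. -/
noncomputable def latticeHessian (E : Submodule ℤ Plane → ℝ) (z : ℝ × ℝ) :
    Matrix (Fin 2) (Fin 2) ℝ :=
  let e : Fin 2 → ℝ × ℝ := ![(1, 0), (0, 1)]
  Matrix.of fun i j => fderiv ℝ (fderiv ℝ (inCoords E)) z (e i) (e j)

/-- The triangular lattice `Λ = √(2/√3) [ℤ (1, 0) ⊕ ℤ (1/2, √3/2)]` of unit density. -/
noncomputable def triangularLattice : Submodule ℤ Plane :=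
  Submodule.span ℤ {√(2 / √3) • !₂[(1 : ℝ), 0], √(2 / √3) • !₂[(1 : ℝ) / 2, √3 / 2]}

/-- The coordinates of the triangular lattice. -/
noncomputable def triangularCoords : ℝ × ℝ := (1 / 2, √3 / 2)

theorem latticeOf_triangularCoords : latticeOf triangularCoords = triangularLattice := by
  have h1 : 1 / √(√3 / 2) = √(2 / √3) := by
    rw [one_div, ← Real.sqrt_inv, inv_div]
  have h2 : √(√3 / 2) = √(2 / √3) * (√3 / 2) := by
    have h0 : √(√3 / 2) ≠ 0 := by positivity
    rw [← h1, div_mul_eq_mul_div, one_mul, eq_div_iff h0, Real.mul_self_sqrt (by positivity)]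
  have h3 : 1 / 2 / √(√3 / 2) = √(2 / √3) * (1 / 2) := by
    rw [← h1]; ring
  have e1 : (!₂[1 / √(√3 / 2), 0] : Plane) = √(2 / √3) • !₂[(1 : ℝ), 0] := by
    ext i; fin_cases i <;> simp [← h1]
  have e2 : (!₂[1 / 2 / √(√3 / 2), √(√3 / 2)] : Plane)
      = √(2 / √3) • !₂[(1 : ℝ) / 2, √3 / 2] := by
    rw [h3, h2]; ext i; fin_cases i <;> simp
  simp only [latticeOf, triangularCoords, triangularLattice]
  rw [e1, e2]

theorem triangularCoords_mem : triangularCoords ∈ fundDomain := by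
  have h : √3 ^ 2 = (3 : ℝ) := Real.sq_sqrt (by norm_num)
  refine ⟨⟨by norm_num [triangularCoords], le_rfl⟩, by simp only [triangularCoords]; positivity, ?_⟩
  simp only [triangularCoords]
  nlinarith

/-! The vector of `L(x, y)` with integer coordinates `p = (m, n)` has squared length `Q_p(x, y) = (m
+ n x)² / y + n² y`. So the energy is the sum of `F(Q_p)` over `p ≠ 0`, where `F` is the Laplace
transform of `μ`.

At `Λ`, rotation by `2π/3` permutes the lattice vectors and preserves their lengths. Over each orbit
the gradients cancel and the second derivatives add up to a multiple of the identity
(`radialGrad_triangularCoords`, `radialHess_triangularCoords`), so only the trace of the Hessian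
matters. From `y² |∇Q|² = Q²` and `y² ΔQ = 2Q`, that trace is a positive multiple of the sum of `s²
F''(s) + 2 s F'(s)` over the squared lengths `s` of nonzero vectors.

For the Gaussian `F(s) = exp(-st)` this sum is `T(t) = ∑ st (st - 2) exp(-st)`. The shortest vectors
have `s = 2/√3`, so every term is positive once `t > √3`. Poisson summation relates the theta
functions at `t` and `π²/t` on every unimodular lattice. Differentiating in the coordinates gives
`T(t) = (π/t) T(π²/t)`, and `t ≤ √3` forces `π²/t > √3`. Hence `T > 0` everywhere
(`thetaLaplacian_pos`).

For general `F` the trace is the integral of `T` against `μ ≠ 0`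
(`hasSum_laplaceTerm_laplaceMoment`), which is positive. Differentiation under the sum is legitimate
because the first two derivatives of `Q_p` are `O(Q_p)` locally uniformly in the coordinates, while
`F`, `s F'` and `s² F''` are all `O(s^(-1-ε))`. The second derivative test concludes, since a small
ball around `Λ` in the lattice distance is contained in a coordinate ball. -/

open Filter Topology

set_option maxSynthPendingDepth 3

/-! ### The quadratic form of a lattice -/

/-- The squared length of the lattice vector with coordinates `p` in the lattice `L(x, y)`. -/
noncomputable def quadForm (p : ℤ × ℤ) (z : ℝ × ℝ) : ℝ :=
  (p.1 + p.2 * z.1) ^ 2 * z.2⁻¹ + p.2 ^ 2 * z.2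

/-- The linear form on `ℝ × ℝ` with the given coefficients. -/
noncomputable def linForm (a b : ℝ) : ℝ × ℝ →L[ℝ] ℝ :=
  a • ContinuousLinearMap.fst ℝ ℝ ℝ + b • ContinuousLinearMap.snd ℝ ℝ ℝ

@[simp] theorem linForm_apply (a b : ℝ) (v : ℝ × ℝ) : linForm a b v = a * v.1 + b * v.2 := by
  simp [linForm]

theorem norm_linForm_le (a b : ℝ) : ‖linForm a b‖ ≤ |a| + |b| := by
  refine (norm_add_le _ _).trans (add_le_add ?_ ?_)
  · rw [norm_smul]
    exact mul_le_of_le_one_right (norm_nonneg _) (ContinuousLinearMap.norm_fst_le ..)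
  · rw [norm_smul]
    exact mul_le_of_le_one_right (norm_nonneg _) (ContinuousLinearMap.norm_snd_le ..)

/-- The symmetric bilinear form on `ℝ × ℝ` with the given coefficients. -/
noncomputable def bilinForm (a b c : ℝ) : ℝ × ℝ →L[ℝ] ℝ × ℝ →L[ℝ] ℝ :=
  (linForm a b).smulRight (ContinuousLinearMap.fst ℝ ℝ ℝ) +
    (linForm b c).smulRight (ContinuousLinearMap.snd ℝ ℝ ℝ)

@[simp] theorem bilinForm_apply (a b c : ℝ) (v w : ℝ × ℝ) :
    bilinForm a b c v w = (a * v.1 + b * v.2) * w.1 + (b * v.1 + c * v.2) * w.2 := by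
  simp [bilinForm]

theorem norm_bilinForm_le (a b c : ℝ) : ‖bilinForm a b c‖ ≤ |a| + |b| + (|b| + |c|) := by
  refine (norm_add_le _ _).trans (add_le_add ?_ ?_)
  · rw [ContinuousLinearMap.norm_smulRight_apply]
    exact (mul_le_of_le_one_right (norm_nonneg _) (ContinuousLinearMap.norm_fst_le ..)).trans
      (norm_linForm_le a b)
  · rw [ContinuousLinearMap.norm_smulRight_apply]
    exact (mul_le_of_le_one_right (norm_nonneg _) (ContinuousLinearMap.norm_snd_le ..)).trans
      (norm_linForm_le b c)

theorem HasFDerivAt.linForm {g h : ℝ × ℝ → ℝ} {a b c : ℝ} {z : ℝ × ℝ}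
    (hg : HasFDerivAt g (linForm a b) z) (hh : HasFDerivAt h (_root_.linForm b c) z) :
    HasFDerivAt (fun w => _root_.linForm (g w) (h w)) (bilinForm a b c) z :=
  (hg.smul_const (ContinuousLinearMap.fst ℝ ℝ ℝ)).add
    (hh.smul_const (ContinuousLinearMap.snd ℝ ℝ ℝ))

theorem ContinuousOn.linForm {g h : ℝ × ℝ → ℝ} {s : Set (ℝ × ℝ)}
    (hg : ContinuousOn g s) (hh : ContinuousOn h s) :
    ContinuousOn (fun w => _root_.linForm (g w) (h w)) s :=
  (hg.smul continuousOn_const).add (hh.smul continuousOn_const)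

theorem ContinuousOn.bilinForm {a b c : ℝ × ℝ → ℝ} {s : Set (ℝ × ℝ)}
    (ha : ContinuousOn a s) (hb : ContinuousOn b s) (hc : ContinuousOn c s) :
    ContinuousOn (fun w => _root_.bilinForm (a w) (b w) (c w)) s := by
  have key (L : ℝ × ℝ →L[ℝ] ℝ) {k : ℝ × ℝ → ℝ × ℝ →L[ℝ] ℝ} (hk : ContinuousOn k s) :
      ContinuousOn (fun w => (k w).smulRight L) s :=
    ((ContinuousLinearMap.smulRightL ℝ (ℝ × ℝ) (ℝ × ℝ →L[ℝ] ℝ)).flip L).continuous.comp_continuousOn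
      hk
  exact (key _ (ha.linForm hb)).add (key _ (hb.linForm hc))

/-- The gradient of `quadForm p`. -/
noncomputable def quadGrad (p : ℤ × ℤ) (z : ℝ × ℝ) : ℝ × ℝ →L[ℝ] ℝ :=
  linForm (2 * p.2 * (p.1 + p.2 * z.1) * z.2⁻¹) (p.2 ^ 2 - (p.1 + p.2 * z.1) ^ 2 * (z.2⁻¹) ^ 2)

/-- The second derivative of `quadForm p`. -/
noncomputable def quadHess (p : ℤ × ℤ) (z : ℝ × ℝ) : ℝ × ℝ →L[ℝ] ℝ × ℝ →L[ℝ] ℝ :=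
  bilinForm (2 * p.2 ^ 2 * z.2⁻¹) (-(2 * p.2 * (p.1 + p.2 * z.1) * (z.2⁻¹) ^ 2))
    (2 * (p.1 + p.2 * z.1) ^ 2 * (z.2⁻¹) ^ 3)

theorem hasFDerivAt_affine (m n : ℝ) (z : ℝ × ℝ) :
    HasFDerivAt (fun w : ℝ × ℝ => m + n * w.1) (linForm n 0) z := by
  refine (((hasFDerivAt_fst (𝕜 := ℝ) (p := z)).const_mul n).const_add m).congr_fderiv ?_
  ext <;> simp

theorem hasFDerivAt_inv_snd {z : ℝ × ℝ} (hz : 0 < z.2) :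
    HasFDerivAt (fun w : ℝ × ℝ => w.2⁻¹) (linForm 0 (-(z.2⁻¹) ^ 2)) z := by
  refine ((hasDerivAt_inv hz.ne').comp_hasFDerivAt z (hasFDerivAt_snd (𝕜 := ℝ))).congr_fderiv ?_
  ext <;> simp

theorem hasFDerivAt_quadForm (p : ℤ × ℤ) {z : ℝ × ℝ} (hz : 0 < z.2) :
    HasFDerivAt (quadForm p) (quadGrad p z) z := by
  have h1 := ((hasFDerivAt_affine p.1 p.2 z).pow 2).mul (hasFDerivAt_inv_snd hz)
  have h2 := (hasFDerivAt_snd (𝕜 := ℝ) (p := z)).const_mul ((p.2 : ℝ) ^ 2)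
  refine (h1.add h2).congr_fderiv ?_
  ext <;> simp [quadGrad] <;> ring

theorem hasFDerivAt_quadGrad (p : ℤ × ℤ) {z : ℝ × ℝ} (hz : 0 < z.2) :
    HasFDerivAt (quadGrad p) (quadHess p z) z := by
  have ha := hasFDerivAt_affine p.1 p.2 z
  have hi := hasFDerivAt_inv_snd hz
  refine HasFDerivAt.linForm ?_ ?_
  · refine ((ha.const_mul (2 * (p.2 : ℝ))).mul hi).congr_fderiv ?_
    ext <;> simp
    ring
  · refine (((ha.pow 2).mul (hi.pow 2)).const_sub ((p.2 : ℝ) ^ 2)).congr_fderiv ?_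
    ext
    all_goals simp
    all_goals field_simp

theorem continuousOn_quadForm (p : ℤ × ℤ) : ContinuousOn (quadForm p) {z | 0 < z.2} :=
  fun _ hz => (hasFDerivAt_quadForm p hz).continuousAt.continuousWithinAt

theorem continuousOn_quadGrad (p : ℤ × ℤ) : ContinuousOn (quadGrad p) {z | 0 < z.2} :=
  fun _ hz => (hasFDerivAt_quadGrad p hz).continuousAt.continuousWithinAt

theorem continuousOn_quadHess (p : ℤ × ℤ) : ContinuousOn (quadHess p) {z | 0 < z.2} := by
  have hi : ContinuousOn (fun z : ℝ × ℝ => z.2⁻¹) {z | 0 < z.2} :=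
    continuousOn_snd.inv₀ fun z hz => ne_of_gt hz
  exact ContinuousOn.bilinForm (by fun_prop) (by fun_prop) (by fun_prop)

/-- A box in the half plane; these boxes exhaust the half plane. -/
def coordBox (R : ℝ) : Set (ℝ × ℝ) := Set.Ioo (-R) R ×ˢ Set.Ioo R⁻¹ R

theorem isOpen_coordBox (R : ℝ) : IsOpen (coordBox R) := isOpen_Ioo.prod isOpen_Ioo

theorem isPreconnected_coordBox (R : ℝ) : IsPreconnected (coordBox R) :=
  ((convex_Ioo _ _).prod (convex_Ioo _ _)).isPreconnected

theorem exists_mem_coordBox {z : ℝ × ℝ} (hz : 0 < z.2) : ∃ R, 1 ≤ R ∧ z ∈ coordBox R := by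
  refine ⟨1 + |z.1| + z.2 + z.2⁻¹, ?_, ?_⟩
  · have := abs_nonneg z.1; have := inv_pos.2 hz; linarith
  · have h0 := abs_nonneg z.1
    have h1 := inv_pos.2 hz
    refine ⟨abs_lt.1 (by linarith), ?_, by linarith⟩
    exact inv_lt_of_inv_lt₀ hz (by linarith)

theorem coordBox_subset {R : ℝ} (hR : 1 ≤ R) : coordBox R ⊆ {z | 0 < z.2} := fun _ hz =>
  (inv_pos.2 (zero_lt_one.trans_le hR)).trans hz.2.1

theorem abs_fst_le_norm (p : ℤ × ℤ) : |(p.1 : ℝ)| ≤ ‖p‖ := by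
  simpa [Int.norm_eq_abs] using norm_fst_le p

theorem abs_snd_le_norm (p : ℤ × ℤ) : |(p.2 : ℝ)| ≤ ‖p‖ := by
  simpa [Int.norm_eq_abs] using norm_snd_le p

/-- With `a = m + n x`, the box gives `Q ≥ (a² + n²) / R`, while `m = a - n x` and `|x| ≤ R` give
`‖p‖² ≤ 2 R² (a² + n²)`. The norm on `ℤ × ℤ` is the sup norm. -/
theorem norm_sq_le_quadForm {R : ℝ} (hR : 1 ≤ R) (p : ℤ × ℤ) {z : ℝ × ℝ} (hz : z ∈ coordBox R) :
    ‖p‖ ^ 2 / (2 * R ^ 3) ≤ quadForm p z := by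
  obtain ⟨⟨hx1, hx2⟩, hy1, hy2⟩ := hz
  have hR0 : 0 < R := by linarith
  have hy : 0 < z.2 := (inv_pos.2 hR0).trans hy1
  have hyi : R⁻¹ ≤ z.2⁻¹ := inv_anti₀ hy hy2.le
  set a : ℝ := p.1 + p.2 * z.1 with ha
  have h1 : R⁻¹ * (a ^ 2 + (p.2 : ℝ) ^ 2) ≤ quadForm p z := by
    have h2 := mul_le_mul_of_nonneg_left hyi (sq_nonneg a)
    have h3 := mul_le_mul_of_nonneg_left hy1.le (sq_nonneg (p.2 : ℝ))
    simp only [quadForm]; linarith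
  have h2 : ‖p‖ ^ 2 ≤ 2 * R ^ 2 * (a ^ 2 + (p.2 : ℝ) ^ 2) := by
    have hR2 : 1 ≤ R ^ 2 := one_le_pow₀ hR
    have e : ‖p‖ = max |(p.1 : ℝ)| |(p.2 : ℝ)| := by simp [Prod.norm_def, Int.norm_eq_abs]
    rcases max_choice |(p.1 : ℝ)| |(p.2 : ℝ)| with h | h <;> rw [e, h, sq_abs]
    · have hx : z.1 ^ 2 ≤ R ^ 2 := sq_le_sq' hx1.le hx2.le
      have h3 : (p.1 : ℝ) ^ 2 ≤ 2 * a ^ 2 + 2 * ((p.2 : ℝ) ^ 2 * z.1 ^ 2) := by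
        have := sq_nonneg (a + p.2 * z.1)
        have e1 : (p.1 : ℝ) = a - p.2 * z.1 := by rw [ha]; ring
        rw [e1]; nlinarith
      have h4 := mul_le_mul_of_nonneg_left hx (sq_nonneg (p.2 : ℝ))
      nlinarith [sq_nonneg a]
    · nlinarith [sq_nonneg a, sq_nonneg (p.2 : ℝ), mul_nonneg (sq_nonneg R) (sq_nonneg a)]
  refine le_trans ?_ h1
  rw [div_le_iff₀ (by positivity)]
  calc ‖p‖ ^ 2 ≤ 2 * R ^ 2 * (a ^ 2 + (p.2 : ℝ) ^ 2) := h2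
    _ = R⁻¹ * (a ^ 2 + (p.2 : ℝ) ^ 2) * (2 * R ^ 3) := by field_simp

theorem quadForm_pos {p : ℤ × ℤ} (hp : p ≠ 0) {z : ℝ × ℝ} (hz : 0 < z.2) : 0 < quadForm p z := by
  obtain ⟨R, hR, hzR⟩ := exists_mem_coordBox hz
  have : 0 < ‖p‖ := norm_pos_iff.2 hp
  exact lt_of_lt_of_le (by positivity) (norm_sq_le_quadForm hR p hzR)

theorem exists_norm_quad_le {R : ℝ} (hR : 1 ≤ R) : ∃ K, 0 ≤ K ∧ ∀ p : ℤ × ℤ, ∀ z ∈ coordBox R,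
    ‖quadGrad p z‖ ≤ K * ‖p‖ ^ 2 ∧ ‖quadHess p z‖ ≤ K * ‖p‖ ^ 2 := by
  have hR0 : 0 < R := by linarith
  -- The gradient bound plus the Hessian bound, so that a single constant serves both; the summands
  -- are those of `hA1`, `hA2` and of `hB1`, `hB2`, `hB2`, `hB3`.
  refine ⟨(4 * R ^ 2 + (1 + 4 * R ^ 4)) + (2 * R + 4 * R ^ 3 + (4 * R ^ 3 + 8 * R ^ 5)),
    by positivity, fun p z ⟨⟨hx1, hx2⟩, hy1, hy2⟩ => ?_⟩
  have hy : 0 < z.2 := (inv_pos.2 hR0).trans hy1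
  have hi : |z.2⁻¹| ≤ R := by
    rw [abs_of_pos (inv_pos.2 hy)]; exact inv_le_of_inv_le₀ hR0 hy1.le
  have hx : |z.1| ≤ R := (abs_lt.2 ⟨hx1, hx2⟩).le
  have hm := abs_fst_le_norm p
  have hn := abs_snd_le_norm p
  set N := ‖p‖
  have hN : 0 ≤ N := norm_nonneg p
  have ha : |(p.1 : ℝ) + p.2 * z.1| ≤ 2 * R * N := by
    calc |(p.1 : ℝ) + p.2 * z.1| ≤ |(p.1 : ℝ)| + |(p.2 : ℝ)| * |z.1| := by
          rw [← abs_mul]; exact abs_add_le _ _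
      _ ≤ N + N * R := by gcongr
      _ ≤ 2 * R * N := by nlinarith
  set a : ℝ := p.1 + p.2 * z.1
  have hA1 : |2 * (p.2 : ℝ) * a * z.2⁻¹| ≤ 4 * R ^ 2 * N ^ 2 := by
    simp only [abs_mul, abs_two]
    calc 2 * |(p.2 : ℝ)| * |a| * |z.2⁻¹| ≤ 2 * N * (2 * R * N) * R := by gcongr
      _ = _ := by ring
  have hA2 : |(p.2 : ℝ) ^ 2 - a ^ 2 * z.2⁻¹ ^ 2| ≤ (1 + 4 * R ^ 4) * N ^ 2 := by
    refine (abs_sub _ _).trans ?_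
    simp only [abs_mul, abs_pow]
    calc |(p.2 : ℝ)| ^ 2 + |a| ^ 2 * |z.2⁻¹| ^ 2 ≤ N ^ 2 + (2 * R * N) ^ 2 * R ^ 2 := by gcongr
      _ = _ := by ring
  have hB1 : |2 * (p.2 : ℝ) ^ 2 * z.2⁻¹| ≤ 2 * R * N ^ 2 := by
    simp only [abs_mul, abs_two, abs_pow]
    calc 2 * |(p.2 : ℝ)| ^ 2 * |z.2⁻¹| ≤ 2 * N ^ 2 * R := by gcongr
      _ = _ := by ring
  have hB2 : |-(2 * (p.2 : ℝ) * a * z.2⁻¹ ^ 2)| ≤ 4 * R ^ 3 * N ^ 2 := by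
    simp only [abs_neg, abs_mul, abs_two, abs_pow]
    calc 2 * |(p.2 : ℝ)| * |a| * |z.2⁻¹| ^ 2 ≤ 2 * N * (2 * R * N) * R ^ 2 := by gcongr
      _ = _ := by ring
  have hB3 : |2 * a ^ 2 * z.2⁻¹ ^ 3| ≤ 8 * R ^ 5 * N ^ 2 := by
    simp only [abs_mul, abs_two, abs_pow]
    calc 2 * |a| ^ 2 * |z.2⁻¹| ^ 3 ≤ 2 * (2 * R * N) ^ 2 * R ^ 3 := by gcongr
      _ = _ := by ring
  constructor
  · refine (norm_linForm_le _ _).trans ((add_le_add hA1 hA2).trans ?_)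
    rw [← add_mul]
    exact mul_le_mul_of_nonneg_right (le_add_of_nonneg_right (by positivity)) (sq_nonneg N)
  · refine (norm_bilinForm_le _ _ _).trans
      ((add_le_add (add_le_add hB1 hB2) (add_le_add hB2 hB3)).trans ?_)
    rw [← add_mul, ← add_mul, ← add_mul]
    exact mul_le_mul_of_nonneg_right (le_add_of_nonneg_left (by positivity)) (sq_nonneg N)

/-- Nonzero integer vectors. -/
abbrev NonzeroIndex : Type := {p : ℤ × ℤ // p ≠ 0}

theorem summable_norm_rpow {k : ℝ} (hk : 2 < k) : Summable fun p : ℤ × ℤ => ‖p‖ ^ (-k) := by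
  rw [← (finTwoArrowEquiv ℤ).summable_iff]
  refine (EisensteinSeries.summable_one_div_norm_rpow hk).congr fun x => ?_
  have e : ‖(finTwoArrowEquiv ℤ) x‖ = ‖x‖ := by
    simp [Prod.norm_def, Int.norm_eq_abs, EisensteinSeries.norm_eq_max_natAbs, Nat.cast_natAbs]
  exact congrArg (· ^ (-k)) e.symm

/-! ### Lattice sums of radial functions as functions of the coordinates -/

/-- A twice continuously differentiable profile on `(0, ∞)` whose derivatives decay fast enough
for lattice sums to be twice continuously differentiable. -/
structure IsRadialProfile (F F₁ F₂ : ℝ → ℝ) (C ε : ℝ) : Prop where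
  eps_pos : 0 < ε
  hasDerivAt : ∀ s, 0 < s → HasDerivAt F (F₁ s) s
  hasDerivAt_deriv : ∀ s, 0 < s → HasDerivAt F₁ (F₂ s) s
  continuousOn : ContinuousOn F₂ (Set.Ioi 0)
  bound : ∀ s, 0 < s → |F s| ≤ C * s ^ (-(1 + ε))
  bound_deriv : ∀ s, 0 < s → |F₁ s| * s ≤ C * s ^ (-(1 + ε))
  bound_deriv₂ : ∀ s, 0 < s → |F₂ s| * s ^ 2 ≤ C * s ^ (-(1 + ε))

/-- The lattice sum of a radial function. -/
noncomputable def radialSum (F : ℝ → ℝ) (z : ℝ × ℝ) : ℝ := ∑' p : NonzeroIndex, F (quadForm p z)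

/-- The gradient of `F ∘ quadForm p`. -/
noncomputable def termGrad (F₁ : ℝ → ℝ) (p : ℤ × ℤ) (z : ℝ × ℝ) : ℝ × ℝ →L[ℝ] ℝ :=
  F₁ (quadForm p z) • quadGrad p z

/-- The second derivative of `F ∘ quadForm p`. -/
noncomputable def termHess (F₁ F₂ : ℝ → ℝ) (p : ℤ × ℤ) (z : ℝ × ℝ) :
    ℝ × ℝ →L[ℝ] ℝ × ℝ →L[ℝ] ℝ :=
  F₁ (quadForm p z) • quadHess p z + (F₂ (quadForm p z) • quadGrad p z).smulRight (quadGrad p z)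

/-- The gradient of `radialSum F`. -/
noncomputable def radialGrad (F₁ : ℝ → ℝ) (z : ℝ × ℝ) : ℝ × ℝ →L[ℝ] ℝ :=
  ∑' p : NonzeroIndex, termGrad F₁ p z

/-- The second derivative of `radialSum F`. -/
noncomputable def radialHess (F₁ F₂ : ℝ → ℝ) (z : ℝ × ℝ) : ℝ × ℝ →L[ℝ] ℝ × ℝ →L[ℝ] ℝ :=
  ∑' p : NonzeroIndex, termHess F₁ F₂ p z

theorem quadForm_rpow_le {R ε : ℝ} (hR : 1 ≤ R) (hε : 0 < ε) {p : ℤ × ℤ} (hp : p ≠ 0) {z : ℝ × ℝ}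
    (hz : z ∈ coordBox R) :
    quadForm p z ^ (-(1 + ε)) ≤ (2 * R ^ 3) ^ (1 + ε) * ‖p‖ ^ (-(2 + 2 * ε)) := by
  have hp : 0 < ‖p‖ := norm_pos_iff.2 hp
  have hB0 : 0 < 2 * R ^ 3 := by positivity
  have h2 : (‖p‖ ^ 2 / (2 * R ^ 3)) ^ (-(1 + ε)) =
      (2 * R ^ 3) ^ (1 + ε) * ‖p‖ ^ (-(2 + 2 * ε)) := by
    rw [Real.div_rpow (by positivity) hB0.le, Real.rpow_neg hB0.le, div_inv_eq_mul, mul_comm,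
      ← Real.rpow_natCast ‖p‖ 2, ← Real.rpow_mul hp.le]
    congr 2; push_cast; ring
  rw [← h2]
  exact Real.rpow_le_rpow_of_nonpos (by positivity) (norm_sq_le_quadForm hR p hz) (by linarith)

theorem summable_quadForm_rpow {ε : ℝ} (hε : 0 < ε) {z : ℝ × ℝ} (hz : 0 < z.2) :
    Summable fun p : NonzeroIndex => quadForm p z ^ (-(1 + ε)) := by
  obtain ⟨R, hR, hzR⟩ := exists_mem_coordBox hz
  refine Summable.of_nonneg_of_le (fun p => Real.rpow_nonneg (quadForm_pos p.2 hz).le _)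
    (fun p => quadForm_rpow_le hR hε p.2 hzR) ?_
  exact ((summable_norm_rpow (by linarith)).comp_injective Subtype.val_injective).mul_left _

namespace IsRadialProfile

variable {F F₁ F₂ : ℝ → ℝ} {C ε : ℝ}

theorem const_nonneg (h : IsRadialProfile F F₁ F₂ C ε) : 0 ≤ C := by
  simpa using (abs_nonneg _).trans (h.bound 1 one_pos)

theorem hasFDerivAt_term (h : IsRadialProfile F F₁ F₂ C ε) {p : ℤ × ℤ} (hp : p ≠ 0) {z : ℝ × ℝ}
    (hz : 0 < z.2) : HasFDerivAt (fun w => F (quadForm p w)) (termGrad F₁ p z) z :=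
  (h.hasDerivAt _ (quadForm_pos hp hz)).comp_hasFDerivAt z (hasFDerivAt_quadForm p hz)

theorem hasFDerivAt_termGrad (h : IsRadialProfile F F₁ F₂ C ε) {p : ℤ × ℤ} (hp : p ≠ 0)
    {z : ℝ × ℝ} (hz : 0 < z.2) :
    HasFDerivAt (termGrad F₁ p) (termHess F₁ F₂ p z) z :=
  ((h.hasDerivAt_deriv _ (quadForm_pos hp hz)).comp_hasFDerivAt z
    (hasFDerivAt_quadForm p hz)).smul (hasFDerivAt_quadGrad p hz)

theorem continuousOn_termHess (h : IsRadialProfile F F₁ F₂ C ε) {p : ℤ × ℤ} (hp : p ≠ 0) :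
    ContinuousOn (termHess F₁ F₂ p) {z | 0 < z.2} := by
  have hF₁ : ContinuousOn (fun z => F₁ (quadForm p z)) {z : ℝ × ℝ | 0 < z.2} := fun z hz =>
    ((h.hasDerivAt_deriv _ (quadForm_pos hp hz)).comp_hasFDerivAt z
      (hasFDerivAt_quadForm p hz)).continuousAt.continuousWithinAt
  have hF₂ : ContinuousOn (fun z => F₂ (quadForm p z)) {z : ℝ × ℝ | 0 < z.2} :=
    h.continuousOn.comp (continuousOn_quadForm p) fun z hz => quadForm_pos hp hz
  refine (hF₁.smul (continuousOn_quadHess p)).add ?_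
  have hc := (ContinuousLinearMap.smulRightL ℝ (ℝ × ℝ) (ℝ × ℝ →L[ℝ] ℝ)).continuous₂
  exact hc.comp_continuousOn
    ((hF₂.smul (continuousOn_quadGrad p)).prodMk (continuousOn_quadGrad p))

/-- A Weierstrass majorant on each box. Both derivatives of `Q` are at most `K ‖p‖² ≤ K B Q`, and
the profile bounds carry exactly the compensating powers of `s`, so all three terms are `O(Q^(-1-ε))
= O(‖p‖^(-2-2ε))`, which is summable in rank two. -/
theorem exists_summable_bound (h : IsRadialProfile F F₁ F₂ C ε) {R : ℝ} (hR : 1 ≤ R) :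
    ∃ u : NonzeroIndex → ℝ, Summable u ∧ ∀ p : NonzeroIndex, ∀ z ∈ coordBox R,
      |F (quadForm p z)| ≤ u p ∧ ‖termGrad F₁ p z‖ ≤ u p ∧ ‖termHess F₁ F₂ p z‖ ≤ u p := by
  obtain ⟨K, hK, hbd⟩ := exists_norm_quad_le hR
  have hR0 : 0 < R := by linarith
  have hC := h.const_nonneg
  have hε := h.eps_pos
  set B : ℝ := 2 * R ^ 3 with hB
  have hB0 : 0 < B := by positivity
  -- The three summands pay for `F`, for `F₁` times one derivative of `Q`, and for `F₂` times a
  -- product of two gradients.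
  set M : ℝ := (1 + K * B + (K * B) ^ 2) * (C * B ^ (1 + ε))
  have hKB : 0 ≤ K * B := by positivity
  refine ⟨fun p => M * ‖(p : ℤ × ℤ)‖ ^ (-(2 + 2 * ε)),
    ((summable_norm_rpow (by linarith)).comp_injective Subtype.val_injective).mul_left M,
    fun p z hz => ?_⟩
  have hz0 : 0 < z.2 := coordBox_subset hR hz
  have hp : 0 < ‖(p : ℤ × ℤ)‖ := norm_pos_iff.2 p.2
  have hQ := quadForm_pos p.2 hz0
  have hQN := norm_sq_le_quadForm hR p hz
  obtain ⟨hg, hh⟩ := hbd p z hz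
  set s := quadForm p z
  set N := ‖(p : ℤ × ℤ)‖
  have hN2 : N ^ 2 ≤ B * s := by rwa [div_le_iff₀' hB0] at hQN
  have hdec : C * s ^ (-(1 + ε)) ≤ C * B ^ (1 + ε) * N ^ (-(2 + 2 * ε)) := by
    rw [mul_assoc]
    exact mul_le_mul_of_nonneg_left (quadForm_rpow_le hR hε p.2 hz) hC
  set D : ℝ := C * B ^ (1 + ε) * N ^ (-(2 + 2 * ε))
  have hD : 0 ≤ D := by positivity
  have hM : M * N ^ (-(2 + 2 * ε)) = (1 + K * B + (K * B) ^ 2) * D := by ring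
  have b0 : |F s| ≤ D := (h.bound s hQ).trans hdec
  have b1 : |F₁ s| * s ≤ D := (h.bound_deriv s hQ).trans hdec
  have b2 : |F₂ s| * s ^ 2 ≤ D := (h.bound_deriv₂ s hQ).trans hdec
  have hKN : K * N ^ 2 ≤ K * B * s := by
    rw [mul_assoc]; exact mul_le_mul_of_nonneg_left hN2 hK
  have c1 : |F₁ s| * (K * N ^ 2) ≤ K * B * D := by
    calc |F₁ s| * (K * N ^ 2) ≤ |F₁ s| * (K * B * s) := by gcongr
      _ = K * B * (|F₁ s| * s) := by ring
      _ ≤ _ := by gcongr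
  have c2 : |F₂ s| * (K * N ^ 2) * (K * N ^ 2) ≤ (K * B) ^ 2 * D := by
    calc |F₂ s| * (K * N ^ 2) * (K * N ^ 2) ≤ |F₂ s| * (K * B * s) * (K * B * s) := by gcongr
      _ = (K * B) ^ 2 * (|F₂ s| * s ^ 2) := by ring
      _ ≤ _ := by gcongr
  have hD1 : 0 ≤ K * B * D := by positivity
  have hD2 : 0 ≤ (K * B) ^ 2 * D := by positivity
  refine ⟨?_, ?_, ?_⟩
  · change _ ≤ M * N ^ (-(2 + 2 * ε))
    rw [hM]; linarith
  · change _ ≤ M * N ^ (-(2 + 2 * ε))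
    rw [hM, termGrad, norm_smul, Real.norm_eq_abs]
    have := mul_le_mul_of_nonneg_left hg (abs_nonneg (F₁ s))
    linarith
  · change _ ≤ M * N ^ (-(2 + 2 * ε))
    rw [hM, termHess]
    refine (norm_add_le _ _).trans ?_
    rw [ContinuousLinearMap.norm_smulRight_apply, norm_smul, norm_smul, Real.norm_eq_abs,
      Real.norm_eq_abs]
    have h1 := mul_le_mul_of_nonneg_left hh (abs_nonneg (F₁ s))
    have h2 : |F₂ s| * ‖quadGrad p z‖ * ‖quadGrad p z‖ ≤ |F₂ s| * (K * N ^ 2) * (K * N ^ 2) := by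
      gcongr
    linarith

theorem summable (h : IsRadialProfile F F₁ F₂ C ε) {z : ℝ × ℝ} (hz : 0 < z.2) :
    Summable fun p : NonzeroIndex => F (quadForm p z) := by
  obtain ⟨R, hR, hzR⟩ := exists_mem_coordBox hz
  obtain ⟨u, hu, hb⟩ := h.exists_summable_bound hR
  exact hu.of_norm_bounded fun p => (hb p z hzR).1

theorem summable_termGrad (h : IsRadialProfile F F₁ F₂ C ε) {z : ℝ × ℝ} (hz : 0 < z.2) :
    Summable fun p : NonzeroIndex => termGrad F₁ p z := by
  obtain ⟨R, hR, hzR⟩ := exists_mem_coordBox hz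
  obtain ⟨u, hu, hb⟩ := h.exists_summable_bound hR
  exact hu.of_norm_bounded fun p => (hb p z hzR).2.1

theorem summable_termHess (h : IsRadialProfile F F₁ F₂ C ε) {z : ℝ × ℝ} (hz : 0 < z.2) :
    Summable fun p : NonzeroIndex => termHess F₁ F₂ p z := by
  obtain ⟨R, hR, hzR⟩ := exists_mem_coordBox hz
  obtain ⟨u, hu, hb⟩ := h.exists_summable_bound hR
  exact hu.of_norm_bounded fun p => (hb p z hzR).2.2

theorem hasFDerivAt_radialSum (h : IsRadialProfile F F₁ F₂ C ε) {z : ℝ × ℝ} (hz : 0 < z.2) :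
    HasFDerivAt (radialSum F) (radialGrad F₁ z) z := by
  obtain ⟨R, hR, hzR⟩ := exists_mem_coordBox hz
  obtain ⟨u, hu, hb⟩ := h.exists_summable_bound hR
  exact hasFDerivAt_tsum_of_isPreconnected hu (isOpen_coordBox R) (isPreconnected_coordBox R)
    (fun p w hw => h.hasFDerivAt_term p.2 (coordBox_subset hR hw))
    (fun p w hw => (hb p w hw).2.1) hzR (h.summable hz) hzR

theorem hasFDerivAt_radialGrad (h : IsRadialProfile F F₁ F₂ C ε) {z : ℝ × ℝ} (hz : 0 < z.2) :
    HasFDerivAt (radialGrad F₁) (radialHess F₁ F₂ z) z := by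
  obtain ⟨R, hR, hzR⟩ := exists_mem_coordBox hz
  obtain ⟨u, hu, hb⟩ := h.exists_summable_bound hR
  exact hasFDerivAt_tsum_of_isPreconnected hu (isOpen_coordBox R) (isPreconnected_coordBox R)
    (fun p w hw => h.hasFDerivAt_termGrad p.2 (coordBox_subset hR hw))
    (fun p w hw => (hb p w hw).2.2) hzR (h.summable_termGrad hz) hzR

theorem continuousOn_radialHess (h : IsRadialProfile F F₁ F₂ C ε) :
    ContinuousOn (radialHess F₁ F₂) {z | 0 < z.2} := by
  intro z hz
  obtain ⟨R, hR, hzR⟩ := exists_mem_coordBox hz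
  obtain ⟨u, hu, hb⟩ := h.exists_summable_bound hR
  have : ContinuousOn (radialHess F₁ F₂) (coordBox R) :=
    continuousOn_tsum (fun p => (h.continuousOn_termHess p.2).mono (coordBox_subset hR)) hu
      fun p w hw => (hb p w hw).2.2
  exact (this.continuousAt ((isOpen_coordBox R).mem_nhds hzR)).continuousWithinAt

theorem contDiffOn_radialSum (h : IsRadialProfile F F₁ F₂ C ε) :
    ContDiffOn ℝ 2 (radialSum F) {z | 0 < z.2} := by
  have ho : IsOpen {z : ℝ × ℝ | 0 < z.2} := isOpen_lt continuous_const continuous_snd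
  have e0 : Set.EqOn (fderiv ℝ (radialSum F)) (radialGrad F₁) {z | 0 < z.2} := fun z hz =>
    (h.hasFDerivAt_radialSum hz).fderiv
  have e1 : Set.EqOn (fderiv ℝ (radialGrad F₁)) (radialHess F₁ F₂) {z | 0 < z.2} := fun z hz =>
    (h.hasFDerivAt_radialGrad hz).fderiv
  rw [← one_add_one_eq_two, contDiffOn_succ_iff_fderiv_of_isOpen ho]
  refine ⟨fun z hz => (h.hasFDerivAt_radialSum hz).differentiableAt.differentiableWithinAt,
    by simp, ContDiffOn.congr ?_ e0⟩
  rw [← zero_add 1, contDiffOn_succ_iff_fderiv_of_isOpen ho]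
  refine ⟨fun z hz => (h.hasFDerivAt_radialGrad hz).differentiableAt.differentiableWithinAt,
    by simp, ContDiffOn.congr ?_ e1⟩
  exact contDiffOn_zero.2 h.continuousOn_radialHess

theorem fderiv_fderiv_radialSum (h : IsRadialProfile F F₁ F₂ C ε) {z : ℝ × ℝ} (hz : 0 < z.2) :
    fderiv ℝ (fderiv ℝ (radialSum F)) z = radialHess F₁ F₂ z := by
  have e : fderiv ℝ (radialSum F) =ᶠ[𝓝 z] radialGrad F₁ := by
    filter_upwards [(isOpen_lt continuous_const continuous_snd).mem_nhds hz] with w hw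
    exact (h.hasFDerivAt_radialSum hw).fderiv
  rw [e.fderiv_eq, (h.hasFDerivAt_radialGrad hz).fderiv]

theorem hasSum_radialHess_apply (h : IsRadialProfile F F₁ F₂ C ε) {z : ℝ × ℝ} (hz : 0 < z.2)
    (v w : ℝ × ℝ) :
    HasSum (fun p : NonzeroIndex => termHess F₁ F₂ p z v w) (radialHess F₁ F₂ z v w) := by
  have h1 : HasSum (fun p : NonzeroIndex => termHess F₁ F₂ p z v) (radialHess F₁ F₂ z v) :=
    (h.summable_termHess hz).hasSum.map
      (ContinuousLinearMap.apply ℝ (ℝ × ℝ →L[ℝ] ℝ) v).toLinearMap.toAddMonoidHom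
      (ContinuousLinearMap.apply ℝ (ℝ × ℝ →L[ℝ] ℝ) v).continuous
  exact h1.map (ContinuousLinearMap.apply ℝ ℝ w).toLinearMap.toAddMonoidHom
    (ContinuousLinearMap.apply ℝ ℝ w).continuous

end IsRadialProfile

/-! ### The symmetry of the triangular lattice -/

/-- The rotation by `2π/3` in the coordinates of the triangular lattice. -/
def latticeRotation : ℤ × ℤ ≃ ℤ × ℤ where
  toFun p := (-p.1 - p.2, p.1)
  invFun p := (p.2, -p.1 - p.2)
  left_inv p := Prod.ext rfl (by dsimp; ring)
  right_inv p := Prod.ext (by dsimp; ring) rfl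

/-- The rotation by `2π/3` acting on nonzero vectors. -/
def nonzeroRotation : NonzeroIndex ≃ NonzeroIndex :=
  latticeRotation.subtypeEquiv fun p => by
    rw [ne_eq, ne_eq, ← latticeRotation.injective.eq_iff (a := p) (b := 0)]; rfl

@[simp] theorem coe_nonzeroRotation (p : NonzeroIndex) :
    (nonzeroRotation p : ℤ × ℤ) = (-(p : ℤ × ℤ).1 - (p : ℤ × ℤ).2, (p : ℤ × ℤ).1) := rfl

/-- The rotation permutes the index set, so `3a` is the sum of the orbit sums. -/
theorem hasSum_zero_of_rotation {T : NonzeroIndex → ℝ} {a : ℝ} (hT : HasSum T a)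
    (h : ∀ p, T p + T (nonzeroRotation p) + T (nonzeroRotation (nonzeroRotation p)) = 0) :
    a = 0 := by
  have h1 : HasSum (T ∘ nonzeroRotation) a := nonzeroRotation.hasSum_iff.2 hT
  have h2 : HasSum ((T ∘ nonzeroRotation) ∘ nonzeroRotation) a := nonzeroRotation.hasSum_iff.2 h1
  have h3 : HasSum (fun _ : NonzeroIndex => (0 : ℝ)) (a + a + a) :=
    ((hT.add h1).add h2).congr_fun fun p => (h p).symm
  have h4 := h3.unique hasSum_zero
  linarith

theorem triangularCoords_snd_pos : 0 < triangularCoords.2 := by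
  simp only [triangularCoords]; positivity

theorem inv_triangularCoords_snd : triangularCoords.2⁻¹ = 2 / 3 * √3 := by
  have h : √3 * √3 = 3 := Real.mul_self_sqrt (by norm_num)
  have h0 : √3 ≠ 0 := by positivity
  simp only [triangularCoords]
  field_simp
  nlinarith

theorem quadForm_triangularCoords (p : ℤ × ℤ) : quadForm p triangularCoords =
    2 / 3 * √3 * ((p.1 : ℝ) ^ 2 + p.1 * p.2 + (p.2 : ℝ) ^ 2) := by
  rw [quadForm, inv_triangularCoords_snd]
  simp only [triangularCoords]
  ring

theorem quadGrad_triangularCoords (p : ℤ × ℤ) : quadGrad p triangularCoords =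
    linForm (√3 * (2 / 3 * (p.2 * (2 * p.1 + p.2))))
      ((p.2 : ℝ) ^ 2 - (2 * p.1 + p.2) ^ 2 / 3) := by
  have h : √3 ^ 2 = 3 := Real.sq_sqrt (by norm_num)
  rw [quadGrad, inv_triangularCoords_snd, mul_pow, h]
  simp only [triangularCoords]
  congr 1 <;> ring

theorem quadHess_triangularCoords (p : ℤ × ℤ) : quadHess p triangularCoords =
    bilinForm (√3 * (4 / 3 * (p.2 : ℝ) ^ 2)) (-(4 / 3 * (p.2 * (2 * p.1 + p.2))))
      (√3 * (4 / 9 * (2 * p.1 + p.2 : ℝ) ^ 2)) := by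
  have h : √3 ^ 2 = 3 := Real.sq_sqrt (by norm_num)
  have h' : √3 ^ 3 = 3 * √3 := by rw [pow_succ, h]
  rw [quadHess, inv_triangularCoords_snd, mul_pow, mul_pow, h, h']
  simp only [triangularCoords]
  congr 1 <;> ring

theorem quadForm_nonzeroRotation (p : NonzeroIndex) :
    quadForm (nonzeroRotation p) triangularCoords = quadForm p triangularCoords := by
  rw [quadForm_triangularCoords, quadForm_triangularCoords, coe_nonzeroRotation]
  push_cast; ring

/-- The contribution of a lattice vector of squared length `s` to the hyperbolic Laplacian. -/
def laplaceTerm (F₁ F₂ : ℝ → ℝ) (s : ℝ) : ℝ := s ^ 2 * F₂ s + 2 * (s * F₁ s)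

/-- The pointwise identities `y² |∇Q|² = Q²` and `y² ΔQ = 2Q`; the factor `4/3` is `1/y²` at `y =
√3/2`. -/
theorem termHess_apply_self (F₁ F₂ : ℝ → ℝ) (p : ℤ × ℤ) :
    termHess F₁ F₂ p triangularCoords (1, 0) (1, 0) +
      termHess F₁ F₂ p triangularCoords (0, 1) (0, 1) =
    4 / 3 * laplaceTerm F₁ F₂ (quadForm p triangularCoords) := by
  have h : √3 ^ 2 = 3 := Real.sq_sqrt (by norm_num)
  rw [termHess, laplaceTerm, quadHess_triangularCoords, quadGrad_triangularCoords]
  set s := quadForm p triangularCoords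
  have hs : s = _ := quadForm_triangularCoords p
  have hs2 : s ^ 2 = 4 / 3 * ((p.1 : ℝ) ^ 2 + p.1 * p.2 + (p.2 : ℝ) ^ 2) ^ 2 := by
    rw [hs, mul_pow, mul_pow, h]; ring
  rw [hs2, mul_comm s]
  -- The seventh occurrence is the bare factor in `F₁ s * s`; the arguments of `F₁` and `F₂` must
  -- stay as they are.
  nth_rewrite 7 [hs]
  simp
  linear_combination F₂ s * ((4 / 9 : ℝ) * (p.2 * (2 * p.1 + p.2)) ^ 2) * h

namespace IsRadialProfile

variable {F F₁ F₂ : ℝ → ℝ} {C ε : ℝ}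

theorem radialGrad_triangularCoords (h : IsRadialProfile F F₁ F₂ C ε) :
    radialGrad F₁ triangularCoords = 0 := by
  refine ContinuousLinearMap.ext fun v => ?_
  have hs := (h.summable_termGrad triangularCoords_snd_pos).hasSum.map
      (ContinuousLinearMap.apply ℝ ℝ v).toLinearMap.toAddMonoidHom
      (ContinuousLinearMap.apply ℝ ℝ v).continuous
  refine hasSum_zero_of_rotation hs fun p => ?_
  change termGrad F₁ _ _ v + termGrad F₁ _ _ v + termGrad F₁ _ _ v = 0
  simp only [termGrad, quadForm_nonzeroRotation]
  simp only [quadGrad_triangularCoords, smul_apply, linForm_apply, coe_nonzeroRotation,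
    smul_eq_mul]
  push_cast
  ring

theorem summable_laplaceTerm (h : IsRadialProfile F F₁ F₂ C ε) :
    Summable fun p : NonzeroIndex => laplaceTerm F₁ F₂ (quadForm p triangularCoords) := by
  have h1 := (h.hasSum_radialHess_apply triangularCoords_snd_pos (1, 0) (1, 0)).summable.add
    (h.hasSum_radialHess_apply triangularCoords_snd_pos (0, 1) (0, 1)).summable
  simp only [termHess_apply_self] at h1
  exact (summable_mul_left_iff (by norm_num)).1 h1

/-- A symmetric bilinear form on the plane invariant under a rotation of order three is scalar,
hence half its trace times the identity: `2/3` is half of `4/3`. Concretely, after subtraction of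
the scalar form every orbit sum vanishes as a polynomial identity. -/
theorem radialHess_triangularCoords (h : IsRadialProfile F F₁ F₂ C ε) (v w : ℝ × ℝ) :
    radialHess F₁ F₂ triangularCoords v w =
      2 / 3 * (∑' p : NonzeroIndex, laplaceTerm F₁ F₂ (quadForm p triangularCoords)) *
        (v.1 * w.1 + v.2 * w.2) := by
  have hs := (h.hasSum_radialHess_apply triangularCoords_snd_pos v w).sub
    (((h.summable_laplaceTerm.hasSum).mul_left (2 / 3)).mul_right (v.1 * w.1 + v.2 * w.2))
  refine sub_eq_zero.1 (hasSum_zero_of_rotation hs fun p => ?_)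
  have hr : √3 ^ 2 = 3 := Real.sq_sqrt (by norm_num)
  simp only [termHess, laplaceTerm, quadForm_nonzeroRotation, quadHess_triangularCoords,
    quadGrad_triangularCoords]
  have hs := quadForm_triangularCoords p
  set s := quadForm p triangularCoords
  have hs2 : s ^ 2 = 4 / 3 * (((p : ℤ × ℤ).1 : ℝ) ^ 2 + (p : ℤ × ℤ).1 * (p : ℤ × ℤ).2 +
      ((p : ℤ × ℤ).2 : ℝ) ^ 2) ^ 2 := by
    rw [hs, mul_pow, mul_pow, hr]; ring
  have e (α β : ℝ) : (√3 * α * v.1 + β * v.2) * (√3 * α * w.1 + β * w.2) =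
      3 * α ^ 2 * (v.1 * w.1) + √3 * (α * β * (v.1 * w.2 + v.2 * w.1)) +
        β ^ 2 * (v.2 * w.2) := by
    linear_combination α ^ 2 * v.1 * w.1 * hr
  simp only [add_apply, smul_apply, bilinForm_apply,
    ContinuousLinearMap.smulRight_apply, linForm_apply, smul_eq_mul, mul_assoc (F₂ s), e, hs2,
    coe_nonzeroRotation]
  have e1 : s * F₁ s = F₁ s * (2 / 3 * √3 * (((p : ℤ × ℤ).1 : ℝ) ^ 2 +
      (p : ℤ × ℤ).1 * (p : ℤ × ℤ).2 + ((p : ℤ × ℤ).2 : ℝ) ^ 2)) := by rw [← hs]; ring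
  rw [e1]
  push_cast
  ring

end IsRadialProfile

/-! ### Gaussian lattice sums -/

/-- Here `ε = 1`. The estimate `u^(k+2) ≤ (k+2)! exp u` at `u = st` bounds `u^k exp(-u)` by `(k+2)!
/ u²`, and `24 = 4!` covers `k ≤ 2`. -/
theorem isRadialProfile_exp {t : ℝ} (ht : 0 < t) :
    IsRadialProfile (fun s => rexp (-(s * t))) (fun s => -(t * rexp (-(s * t))))
      (fun s => t ^ 2 * rexp (-(s * t))) (24 / t ^ 2) 1 := by
  have hd (s : ℝ) : HasDerivAt (fun s => rexp (-(s * t))) (-(t * rexp (-(s * t)))) s := by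
    have := ((hasDerivAt_id s).mul_const t).neg.exp
    refine this.congr_deriv ?_
    simp; ring
  have hk (k : ℕ) (s : ℝ) (hs : 0 < s) (hk : (k + 2).factorial ≤ 24) :
      (s * t) ^ k * rexp (-(s * t)) ≤ 24 / t ^ 2 * s ^ (-(1 + 1 : ℝ)) := by
    have h0 : 0 < s * t := mul_pos hs ht
    have h1 := Real.pow_div_factorial_le_exp _ h0.le (k + 2)
    have hf : (0 : ℝ) < (k + 2).factorial := by positivity
    have hk' : ((k + 2).factorial : ℝ) ≤ 24 := by exact_mod_cast hk
    rw [div_le_iff₀ hf] at h1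
    have e : s ^ (-(1 + 1 : ℝ)) = (s ^ 2)⁻¹ := by
      rw [Real.rpow_neg hs.le, show (1 + 1 : ℝ) = (2 : ℕ) by norm_num, Real.rpow_natCast]
    rw [e, Real.exp_neg, ← div_eq_mul_inv, ← div_eq_mul_inv, div_div, ← mul_pow, mul_comm t s,
      div_le_div_iff₀ (Real.exp_pos _) (by positivity), ← pow_add]
    exact h1.trans (by nlinarith [Real.exp_pos (s * t)])
  refine ⟨one_pos, fun s _ => hd s, fun s _ => ?_, by fun_prop, fun s hs => ?_, fun s hs => ?_,
    fun s hs => ?_⟩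
  · refine (((hd s).const_mul t).neg).congr_deriv ?_
    ring
  · have := hk 0 s hs (by decide)
    rw [pow_zero, one_mul] at this
    rwa [abs_of_pos (Real.exp_pos _)]
  · have := hk 1 s hs (by decide)
    rw [abs_neg, abs_of_pos (by positivity)]
    linarith
  · have := hk 2 s hs (by decide)
    rw [abs_of_pos (by positivity)]
    linarith

theorem quadForm_zero (z : ℝ × ℝ) : quadForm 0 z = 0 := by simp [quadForm]

theorem summable_exp_quadForm {t : ℝ} (ht : 0 < t) {z : ℝ × ℝ} (hz : 0 < z.2) :
    Summable fun p : ℤ × ℤ => rexp (-(quadForm p z * t)) := by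
  rw [← (Set.finite_singleton (0 : ℤ × ℤ)).summable_compl_iff]
  exact (isRadialProfile_exp ht).summable hz

theorem tsum_exp_quadForm {t : ℝ} (ht : 0 < t) {z : ℝ × ℝ} (hz : 0 < z.2) :
    ∑' p : ℤ × ℤ, rexp (-(quadForm p z * t)) = 1 + radialSum (fun s => rexp (-(s * t))) z := by
  rw [← (summable_exp_quadForm ht hz).tsum_subtype_add_tsum_subtype_compl {0}]
  congr 1
  simp [quadForm_zero]

/-- One-dimensional Poisson summation in `m`: the shift by `n x` becomes a phase in the dual
variable `k`. -/
theorem tsum_gaussian_row {t x y : ℝ} (ht : 0 < t) (hy : 0 < y) (n : ℤ) :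
    ∑' m : ℤ, Complex.exp (-((t / y : ℝ) * ((m : ℂ) + n * x) ^ 2)) =
      √(π * y / t) * ∑' k : ℤ,
        Complex.exp (-((π ^ 2 * y / t : ℝ) * (k : ℂ) ^ 2) - 2 * π * Complex.I * (n * x) * k) := by
  have ha : 0 < π * y / t := by positivity
  have h := Complex.tsum_exp_neg_quadratic (a := (π * y / t : ℝ))
    (by rw [Complex.ofReal_re]; exact ha) (-(Complex.I * (n * x)))
  have hs : (((π * y / t : ℝ) : ℂ)) ^ (1 / 2 : ℂ) = (√(π * y / t) : ℝ) := by
    rw [Real.sqrt_eq_rpow, Complex.ofReal_cpow ha.le]; norm_num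
  rw [hs] at h
  have hs0 : ((√(π * y / t) : ℝ) : ℂ) ≠ 0 := by
    rw [Complex.ofReal_ne_zero]; exact (Real.sqrt_pos.2 ha).ne'
  have e (k : ℤ) :
      -((π ^ 2 * y / t : ℝ) * (k : ℂ) ^ 2) - 2 * π * Complex.I * (n * x) * k =
        -π * (π * y / t : ℝ) * (k : ℂ) ^ 2 + 2 * π * -(Complex.I * (n * x)) * k := by
    push_cast
    ring
  simp only [e]
  rw [h, ← mul_assoc, mul_one_div_cancel hs0, one_mul]
  refine tsum_congr fun m => ?_
  congr 1
  have hI : Complex.I * -(Complex.I * (n * x)) = n * x := by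
    rw [mul_neg, ← mul_assoc, Complex.I_mul_I]; ring
  rw [hI, ← neg_mul]
  congr 1
  have hy' : (y : ℂ) ≠ 0 := by exact_mod_cast hy.ne'
  have ht' : (t : ℂ) ≠ 0 := by exact_mod_cast ht.ne'
  have hpi : (π : ℂ) ≠ 0 := by exact_mod_cast Real.pi_ne_zero
  push_cast
  field_simp

/-- This is `tsum_gaussian_row` with `π²/t` in place of `t` and the two sides exchanged. -/
theorem tsum_gaussian_column {t x y : ℝ} (ht : 0 < t) (hy : 0 < y) (k : ℤ) :
    ∑' n : ℤ, Complex.exp (-((t * y : ℝ) * (n : ℂ) ^ 2) - 2 * π * Complex.I * (n * x) * k) =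
      √(π / (t * y)) *
        ∑' l : ℤ, Complex.exp (-((π ^ 2 / (t * y) : ℝ) * ((l : ℂ) + k * x) ^ 2)) := by
  have h := tsum_gaussian_row (t := π ^ 2 / t) (x := x) (by positivity) hy k
  have e1 : π ^ 2 / t / y = π ^ 2 / (t * y) := by field_simp
  have e2 : π ^ 2 * y / (π ^ 2 / t) = t * y := by field_simp
  have e3 : √(π / (t * y)) * √(π * y / (π ^ 2 / t)) = 1 := by
    rw [← Real.sqrt_mul (by positivity), ← Real.sqrt_one]
    congr 1
    field_simp
  rw [e1, e2] at h
  rw [h, ← mul_assoc, ← Complex.ofReal_mul, e3, Complex.ofReal_one, one_mul]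
  refine tsum_congr fun n => congrArg _ ?_
  ring

theorem summable_gaussian_twist {t x y : ℝ} (ht : 0 < t) (hy : 0 < y) :
    Summable fun p : ℤ × ℤ => Complex.exp (-((t * y : ℝ) * (p.2 : ℂ) ^ 2)) *
      Complex.exp (-((π ^ 2 * y / t : ℝ) * (p.1 : ℂ) ^ 2) -
        2 * π * Complex.I * (p.2 * x) * p.1) := by
  -- The phase has modulus one, so the norms form a Gaussian sum over the rectangular lattice at
  -- `(0, t/π)`.
  have h := summable_exp_quadForm (t := π * y) (by positivity) (z := (0, t / π))
    (show 0 < t / π by positivity)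
  refine Summable.of_norm (h.congr fun p => ?_)
  rw [← Complex.exp_add, Complex.norm_exp]
  congr 1
  have e : (-((t * y : ℝ) * (p.2 : ℂ) ^ 2) + (-((π ^ 2 * y / t : ℝ) * (p.1 : ℂ) ^ 2) -
      2 * π * Complex.I * (p.2 * x) * p.1)) =
      ((-(t * y * (p.2 : ℝ) ^ 2) - π ^ 2 * y / t * (p.1 : ℝ) ^ 2 : ℝ) : ℂ) +
        ((-(2 * π * (p.2 * x) * p.1) : ℝ) : ℂ) * Complex.I := by
    push_cast
    ring
  rw [e, Complex.add_re, Complex.ofReal_re, Complex.re_ofReal_mul, Complex.I_re, mul_zero,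
    add_zero]
  simp only [quadForm]
  field_simp
  ring

/-- Poisson summation in each variable in turn, `m` to `k` and `n` to `l`. The dual form comes out
as the same `quadForm` at `(l, k)`, with the roles of the indices exchanged, because a unimodular
planar lattice is its own dual up to a quarter turn. -/
theorem theta_functional_equation {t : ℝ} (ht : 0 < t) {z : ℝ × ℝ} (hz : 0 < z.2) :
    ∑' p : ℤ × ℤ, rexp (-(quadForm p z * t)) =
      π / t * ∑' p : ℤ × ℤ, rexp (-(quadForm p z * (π ^ 2 / t))) := by
  obtain ⟨x, y⟩ := z
  replace hz : 0 < y := hz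
  have hsum {s : ℝ} (hs : 0 < s) : Summable fun p : ℤ × ℤ =>
      (rexp (-(quadForm p (x, y) * s)) : ℂ) :=
    Complex.ofRealCLM.summable (summable_exp_quadForm hs hz)
  have hsplit {s : ℝ} (p : ℤ × ℤ) : (rexp (-(quadForm p (x, y) * s)) : ℂ) =
      Complex.exp (-((s * y : ℝ) * (p.2 : ℂ) ^ 2)) *
        Complex.exp (-((s / y : ℝ) * ((p.1 : ℂ) + p.2 * x) ^ 2)) := by
    rw [← Complex.exp_add, Complex.ofReal_exp]
    congr 1
    simp only [quadForm]
    push_cast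
    ring
  have hprod : √(π * y / t) * √(π / (t * y)) = π / t := by
    rw [← Real.sqrt_mul (by positivity), show π * y / t * (π / (t * y)) = (π / t) ^ 2 by field_simp,
      Real.sqrt_sq (by positivity)]
  apply Complex.ofReal_injective
  rw [Complex.ofReal_mul, Complex.ofReal_tsum, Complex.ofReal_tsum]
  have hs' : 0 < π ^ 2 / t := by positivity
  calc ∑' p : ℤ × ℤ, (rexp (-(quadForm p (x, y) * t)) : ℂ)
      = ∑' (n : ℤ) (m : ℤ), (rexp (-(quadForm (m, n) (x, y) * t)) : ℂ) := by
        rw [(hsum ht).tsum_prod]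
        exact Summable.tsum_comm (f := fun n m => (rexp (-(quadForm (m, n) (x, y) * t)) : ℂ))
          (hsum ht).prod_symm
    _ = ∑' (n : ℤ) (k : ℤ), √(π * y / t) * (Complex.exp (-((t * y : ℝ) * (n : ℂ) ^ 2)) *
          Complex.exp (-((π ^ 2 * y / t : ℝ) * (k : ℂ) ^ 2) -
            2 * π * Complex.I * (n * x) * k)) := by
        refine tsum_congr fun n => ?_
        simp only [hsplit, tsum_mul_left]
        rw [tsum_gaussian_row ht hz]
        ring
    _ = ∑' (k : ℤ) (n : ℤ), √(π * y / t) * (Complex.exp (-((t * y : ℝ) * (n : ℂ) ^ 2)) *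
          Complex.exp (-((π ^ 2 * y / t : ℝ) * (k : ℂ) ^ 2) -
            2 * π * Complex.I * (n * x) * k)) :=
        Summable.tsum_comm (f := fun k n : ℤ => √(π * y / t) *
          (Complex.exp (-((t * y : ℝ) * (n : ℂ) ^ 2)) *
          Complex.exp (-((π ^ 2 * y / t : ℝ) * (k : ℂ) ^ 2) -
            2 * π * Complex.I * (n * x) * k))) ((summable_gaussian_twist ht hz).mul_left _)
    _ = ∑' (k : ℤ) (l : ℤ), (π / t : ℝ) * (rexp (-(quadForm (l, k) (x, y) * (π ^ 2 / t))) : ℂ) := by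
        refine tsum_congr fun k => ?_
        have e (n : ℤ) : Complex.exp (-((t * y : ℝ) * (n : ℂ) ^ 2)) *
            Complex.exp (-((π ^ 2 * y / t : ℝ) * (k : ℂ) ^ 2) - 2 * π * Complex.I * (n * x) * k) =
            Complex.exp (-((π ^ 2 * y / t : ℝ) * (k : ℂ) ^ 2)) *
            Complex.exp (-((t * y : ℝ) * (n : ℂ) ^ 2) - 2 * π * Complex.I * (n * x) * k) := by
          rw [← Complex.exp_add, ← Complex.exp_add]
          congr 1
          ring
        simp only [e, hsplit, tsum_mul_left]
        rw [tsum_gaussian_column ht hz, ← hprod, Complex.ofReal_mul,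
          show π ^ 2 / t * y = π ^ 2 * y / t by ring,
          show π ^ 2 / t / y = π ^ 2 / (t * y) by field_simp]
        ring
    _ = _ := by
        rw [(hsum hs').tsum_prod, ← tsum_mul_left]
        simp only [tsum_mul_left]
        congr 1
        exact Summable.tsum_comm
          (f := fun k l => (rexp (-(quadForm (l, k) (x, y) * (π ^ 2 / t))) : ℂ))
          (hsum hs').prod_symm |>.symm

/-- The hyperbolic Laplacian of the theta function at the triangular lattice. -/
noncomputable def thetaLaplacian (t : ℝ) : ℝ :=
  ∑' p : NonzeroIndex,
    (fun s => (s * t) * (s * t - 2) * rexp (-(s * t))) (quadForm p triangularCoords)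

theorem laplaceTerm_exp (t s : ℝ) :
    laplaceTerm (fun s => -(t * rexp (-(s * t)))) (fun s => t ^ 2 * rexp (-(s * t))) s =
      (s * t) * (s * t - 2) * rexp (-(s * t)) := by
  simp only [laplaceTerm]; ring

theorem fderiv_fderiv_theta {t : ℝ} (ht : 0 < t) :
    fderiv ℝ (fderiv ℝ (radialSum fun s => rexp (-(s * t)))) triangularCoords (1, 0) (1, 0) =
      2 / 3 * thetaLaplacian t := by
  have h := isRadialProfile_exp ht
  rw [h.fderiv_fderiv_radialSum triangularCoords_snd_pos, h.radialHess_triangularCoords]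
  simp only [laplaceTerm_exp, thetaLaplacian]
  ring

theorem thetaLaplacian_functional_equation {t : ℝ} (ht : 0 < t) :
    thetaLaplacian t = π / t * thetaLaplacian (π ^ 2 / t) := by
  have hs' : 0 < π ^ 2 / t := by positivity
  -- The omitted zero vector contributes only the constant `π/t - 1`, which disappears on
  -- differentiation.
  have e : radialSum (fun s => rexp (-(s * t))) =ᶠ[𝓝 triangularCoords] fun z =>
      (π / t) • radialSum (fun s => rexp (-(s * (π ^ 2 / t)))) z + (π / t - 1) := by
    filter_upwards [(isOpen_lt continuous_const continuous_snd).mem_nhds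
      triangularCoords_snd_pos] with z hz
    have h := theta_functional_equation ht hz
    rw [tsum_exp_quadForm ht hz, tsum_exp_quadForm hs' hz] at h
    rw [smul_eq_mul]
    linarith
  have e1 : fderiv ℝ (radialSum fun s => rexp (-(s * t))) =ᶠ[𝓝 triangularCoords]
      fun z => (π / t) • fderiv ℝ (radialSum fun s => rexp (-(s * (π ^ 2 / t)))) z := by
    refine e.fderiv.trans ?_
    filter_upwards [(isOpen_lt continuous_const continuous_snd).mem_nhds
      triangularCoords_snd_pos] with z hz
    rw [fderiv_add_const]
    exact fderiv_fun_const_smul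
      ((isRadialProfile_exp hs').hasFDerivAt_radialSum hz).differentiableAt _
  have e2 : fderiv ℝ (fderiv ℝ (radialSum fun s => rexp (-(s * t)))) triangularCoords =
      fderiv ℝ (fun z => (π / t) • fderiv ℝ (radialSum fun s => rexp (-(s * (π ^ 2 / t)))) z)
        triangularCoords := e1.fderiv_eq
  have hd : DifferentiableAt ℝ (fderiv ℝ (radialSum fun s => rexp (-(s * (π ^ 2 / t)))))
      triangularCoords := by
    have hr := ((isRadialProfile_exp hs').hasFDerivAt_radialGrad triangularCoords_snd_pos)
    refine hr.differentiableAt.congr_of_eventuallyEq ?_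
    filter_upwards [(isOpen_lt continuous_const continuous_snd).mem_nhds
      triangularCoords_snd_pos] with z hz
    exact ((isRadialProfile_exp hs').hasFDerivAt_radialSum hz).fderiv
  rw [fderiv_fun_const_smul hd] at e2
  have e3 := congrArg (fun L => L (1, 0) (1, 0)) e2
  simp only [smul_apply, fderiv_fderiv_theta ht, fderiv_fderiv_theta hs', smul_eq_mul] at e3
  linarith

theorem two_div_three_mul_sqrt_le_quadForm (p : NonzeroIndex) :
    2 / 3 * √3 ≤ quadForm p triangularCoords := by
  rw [quadForm_triangularCoords]
  refine le_mul_of_one_le_right (by positivity) ?_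
  obtain ⟨⟨m, n⟩, hp⟩ := p
  have h : 0 < m ^ 2 + m * n + n ^ 2 := by
    by_contra! h0
    have hm : m = 0 := by
      have : 3 * m ^ 2 ≤ 0 := by nlinarith [sq_nonneg (m + 2 * n)]
      exact pow_eq_zero_iff two_ne_zero |>.1 (le_antisymm (by linarith) (sq_nonneg m))
    have hn : n = 0 := by
      subst hm
      exact pow_eq_zero_iff two_ne_zero |>.1 (le_antisymm (by linarith) (sq_nonneg n))
    exact hp (by rw [hm, hn]; rfl)
  have h1 : 1 ≤ m ^ 2 + m * n + n ^ 2 := h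
  exact_mod_cast h1

/-- The threshold is where the shortest vectors reach `st = 2`: `(2/√3) · √3 = 2`. Beyond it every
term is positive. -/
theorem thetaLaplacian_pos_of_le {t : ℝ} (ht : √3 < t) : 0 < thetaLaplacian t := by
  have h3 : √3 * √3 = 3 := Real.mul_self_sqrt (by norm_num)
  have h0 : 0 < √3 := by positivity
  have ht0 : 0 < t := h0.trans ht
  have key (p : NonzeroIndex) : 2 < quadForm p triangularCoords * t := by
    have := two_div_three_mul_sqrt_le_quadForm p
    calc (2 : ℝ) = 2 / 3 * √3 * √3 := by rw [mul_assoc, h3]; norm_num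
      _ < 2 / 3 * √3 * t := by gcongr
      _ ≤ _ := by gcongr
  have hpos (p : NonzeroIndex) : 0 < (fun s => (s * t) * (s * t - 2) * rexp (-(s * t)))
      (quadForm p triangularCoords) := by
    have := key p
    exact mul_pos (mul_pos (by linarith) (by linarith)) (Real.exp_pos _)
  refine Summable.tsum_pos ?_ (fun p => (hpos p).le) ⟨(1, 0), by simp⟩ (hpos _)
  exact (isRadialProfile_exp ht0).summable_laplaceTerm.congr fun p => laplaceTerm_exp t _

/-- The involution `t ↦ π²/t` fixes `π > √3`, so it carries `(0, √3]` into the range where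
positivity is termwise. -/
theorem thetaLaplacian_pos {t : ℝ} (ht : 0 < t) : 0 < thetaLaplacian t := by
  have h3 : √3 < 3 := by
    rw [Real.sqrt_lt' (by norm_num)]; norm_num
  rcases lt_or_ge (√3) t with h | h
  · exact thetaLaplacian_pos_of_le h
  · rw [thetaLaplacian_functional_equation ht]
    refine mul_pos (by positivity) (thetaLaplacian_pos_of_le ?_)
    rw [lt_div_iff₀ ht]
    nlinarith [Real.pi_gt_three]

/-! ### Laplace transforms -/

/-- Integrability of `thetaLaplacian` is needed to deduce positivity of its integral from positivity
of the integrand. -/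
theorem MeasureTheory.integrable_tsum_of_summable_integral_norm {α ι : Type*} [Countable ι]
    {m : MeasurableSpace α} {μ : Measure α} {g : ι → α → ℝ} (hg : ∀ i, Integrable (g i) μ)
    (hs : Summable fun i => ∫ a, ‖g i a‖ ∂μ) (hp : ∀ a, Summable fun i => g i a) :
    Integrable (fun a => ∑' i, g i a) μ := by
  refine ⟨aestronglyMeasurable_of_tendsto_ae (u := atTop)
    (f := fun (s : Finset ι) a => ∑ i ∈ s, g i a)
    (fun s => (integrable_finsetSum s fun i _ => hg i).1)
    (ae_of_all _ fun a => (hp a).hasSum), ?_⟩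
  calc ∫⁻ a, ‖∑' i, g i a‖ₑ ∂μ ≤ ∫⁻ a, ∑' i, ‖g i a‖ₑ ∂μ :=
        lintegral_mono fun a => enorm_tsum_le_tsum_enorm
    _ = ∑' i, ∫⁻ a, ‖g i a‖ₑ ∂μ := lintegral_tsum fun i => (hg i).1.enorm
    _ = ∑' i, ENNReal.ofReal (∫ a, ‖g i a‖ ∂μ) :=
        tsum_congr fun i => (ofReal_integral_norm_eq_lintegral_enorm (hg i)).symm
    _ < ∞ := by
        rw [← ENNReal.ofReal_tsum_of_nonneg (fun i => integral_nonneg fun a => norm_nonneg _) hs]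
        exact ENNReal.ofReal_lt_top

/-- The `k`-th derivative (up to sign) of the Laplace transform of a measure on `(0, ∞)`. -/
noncomputable def laplaceMoment (μ : Measure (Set.Ioi (0 : ℝ))) (k : ℕ) (s : ℝ) : ℝ :=
  ∫ t : Set.Ioi (0 : ℝ), (t : ℝ) ^ k * rexp (-(s * (t : ℝ))) ∂μ

section

variable {μ : Measure (Set.Ioi (0 : ℝ))}

/-- Half of the exponential absorbs the power, since `(st)^k ≤ k! exp(st)`. All moments of `μ` are
thereby controlled by its Laplace transform at half the argument, even if `μ` is infinite. -/
theorem pow_mul_exp_neg_le (k : ℕ) {s t : ℝ} (hs : 0 < s) (ht : 0 < t) :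
    s ^ k * (t ^ k * rexp (-(2 * s * t))) ≤ k.factorial * rexp (-(s * t)) := by
  have h0 : 0 < s * t := mul_pos hs ht
  have h1 := Real.pow_div_factorial_le_exp _ h0.le k
  rw [div_le_iff₀ (by positivity)] at h1
  have e : rexp (-(2 * s * t)) = rexp (-(s * t)) * rexp (-(s * t)) := by
    rw [← Real.exp_add]; ring_nf
  calc s ^ k * (t ^ k * rexp (-(2 * s * t)))
      = (s * t) ^ k * (rexp (-(s * t)) * rexp (-(s * t))) := by rw [e, mul_pow]; ring
    _ ≤ rexp (s * t) * k.factorial * (rexp (-(s * t)) * rexp (-(s * t))) := by gcongr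
    _ = k.factorial * rexp (-(s * t)) * (rexp (s * t) * rexp (-(s * t))) := by ring
    _ = _ := by rw [← Real.exp_add]; simp

theorem integrable_pow_mul_exp
    (hμ : ∀ s, 0 < s → Integrable (fun t : Set.Ioi (0 : ℝ) => rexp (-(s * (t : ℝ)))) μ)
    (k : ℕ) {s : ℝ} (hs : 0 < s) :
    Integrable (fun t : Set.Ioi (0 : ℝ) => (t : ℝ) ^ k * rexp (-(s * (t : ℝ)))) μ := by
  have hs2 : 0 < s / 2 := by positivity
  refine ((hμ (s / 2) hs2).const_mul (k.factorial / (s / 2) ^ k)).mono'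
    (by fun_prop) (ae_of_all _ fun t => ?_)
  have ht : 0 < (t : ℝ) := t.2
  have h := pow_mul_exp_neg_le k hs2 ht
  rw [mul_div_cancel₀ _ two_ne_zero] at h
  rw [Real.norm_of_nonneg (by positivity), div_mul_eq_mul_div, le_div_iff₀ (by positivity)]
  linarith

theorem hasDerivAt_laplaceMoment
    (hμ : ∀ s, 0 < s → Integrable (fun t : Set.Ioi (0 : ℝ) => rexp (-(s * (t : ℝ)))) μ)
    (k : ℕ) {s : ℝ} (hs : 0 < s) :
    HasDerivAt (laplaceMoment μ k) (-laplaceMoment μ (k + 1) s) s := by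
  have hs2 : 0 < s / 2 := by positivity
  have h := hasDerivAt_integral_of_dominated_loc_of_deriv_le (μ := μ) (x₀ := s)
    (F := fun s (t : Set.Ioi (0 : ℝ)) => (t : ℝ) ^ k * rexp (-(s * (t : ℝ))))
    (F' := fun s (t : Set.Ioi (0 : ℝ)) => -((t : ℝ) ^ (k + 1) * rexp (-(s * (t : ℝ)))))
    (bound := fun t : Set.Ioi (0 : ℝ) => (t : ℝ) ^ (k + 1) * rexp (-(s / 2 * (t : ℝ))))
    -- Staying to the right of `s / 2` lets the integrand at `s / 2` dominate all nearby ones.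
    (s := Set.Ioi (s / 2)) (Ioi_mem_nhds (by linarith))
    (by filter_upwards with x; fun_prop) (integrable_pow_mul_exp hμ k hs)
    (by fun_prop) ?_ (integrable_pow_mul_exp hμ (k + 1) hs2) ?_
  · have e := h.2
    rwa [integral_neg] at e
  · refine ae_of_all _ fun t x hx => ?_
    have ht : 0 < (t : ℝ) := t.2
    have hx' : s / 2 ≤ x := le_of_lt hx
    rw [norm_neg, Real.norm_of_nonneg (by positivity)]
    gcongr
  · refine ae_of_all _ fun t x _ => ?_
    have := (((hasDerivAt_id x).mul_const (t : ℝ)).neg.exp).const_mul ((t : ℝ) ^ k)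
    refine this.congr_deriv ?_
    simp; ring

theorem laplaceMoment_nonneg (k : ℕ) (s : ℝ) : 0 ≤ laplaceMoment μ k s :=
  integral_nonneg fun t => mul_nonneg (pow_nonneg (le_of_lt t.2) k) (Real.exp_pos _).le

theorem pow_mul_laplaceMoment_le
    (hμ : ∀ s, 0 < s → Integrable (fun t : Set.Ioi (0 : ℝ) => rexp (-(s * (t : ℝ)))) μ)
    (k : ℕ) {s : ℝ} (hs : 0 < s) :
    s ^ k * laplaceMoment μ k s ≤ 2 ^ k * k.factorial * laplaceMoment μ 0 (s / 2) := by
  have hs2 : 0 < s / 2 := by positivity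
  simp only [laplaceMoment, ← integral_const_mul]
  refine integral_mono ((integrable_pow_mul_exp hμ k hs).const_mul _)
    ((integrable_pow_mul_exp hμ 0 hs2).const_mul _) fun t => ?_
  have h := pow_mul_exp_neg_le k hs2 (show 0 < (t : ℝ) from t.2)
  rw [mul_div_cancel₀ _ two_ne_zero, div_pow] at h
  have h2 : (0 : ℝ) < 2 ^ k := by positivity
  dsimp only
  rw [pow_zero, one_mul, mul_assoc]
  calc s ^ k * ((t : ℝ) ^ k * rexp (-(s * t)))
      = 2 ^ k * (s ^ k / 2 ^ k * ((t : ℝ) ^ k * rexp (-(s * t)))) := by field_simp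
    _ ≤ _ := by gcongr

/-- Decay of the transform alone suffices: complete monotonicity passes it on to the derivatives.
The factor `8` is the largest `2^k k!` with `k ≤ 2`, and `2^(1+ε)` comes from evaluating at `s / 2`.
-/
theorem isRadialProfile_laplaceMoment
    (hμ : ∀ s, 0 < s → Integrable (fun t : Set.Ioi (0 : ℝ) => rexp (-(s * (t : ℝ)))) μ)
    {C ε : ℝ} (hε : 0 < ε) (hb : ∀ s, 0 < s → laplaceMoment μ 0 s ≤ C * s ^ (-(1 + ε))) :
    IsRadialProfile (laplaceMoment μ 0) (fun s => -laplaceMoment μ 1 s) (laplaceMoment μ 2)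
      (8 * (C * 2 ^ (1 + ε))) ε := by
  have hC : 0 ≤ C := by simpa using (laplaceMoment_nonneg 0 1).trans (hb 1 one_pos)
  have hb2 (s : ℝ) (hs : 0 < s) :
      laplaceMoment μ 0 (s / 2) ≤ C * 2 ^ (1 + ε) * s ^ (-(1 + ε)) := by
    refine (hb (s / 2) (by positivity)).trans_eq ?_
    rw [Real.div_rpow hs.le two_pos.le, Real.rpow_neg two_pos.le, div_inv_eq_mul]
    ring
  have hpos (s : ℝ) (hs : 0 < s) : 0 ≤ C * 2 ^ (1 + ε) * s ^ (-(1 + ε)) := by positivity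
  refine ⟨hε, fun s hs => hasDerivAt_laplaceMoment hμ 0 hs, fun s hs => ?_, fun s hs => ?_,
    fun s hs => ?_, fun s hs => ?_, fun s hs => ?_⟩
  · exact (hasDerivAt_laplaceMoment hμ 1 hs).neg.congr_deriv (neg_neg _)
  · exact (hasDerivAt_laplaceMoment hμ 2 hs).continuousAt.continuousWithinAt
  · rw [abs_of_nonneg (laplaceMoment_nonneg 0 s)]
    have h := pow_mul_laplaceMoment_le hμ 0 hs
    simp only [pow_zero, Nat.factorial_zero, Nat.cast_one, one_mul] at h
    linarith [hb2 s hs, hpos s hs]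
  · rw [abs_neg, abs_of_nonneg (laplaceMoment_nonneg 1 s)]
    have h := pow_mul_laplaceMoment_le hμ 1 hs
    simp only [pow_one, Nat.factorial_one, Nat.cast_one, mul_one] at h
    linarith [hb2 s hs, hpos s hs]
  · rw [abs_of_nonneg (laplaceMoment_nonneg 2 s)]
    have h := pow_mul_laplaceMoment_le hμ 2 hs
    simp only [Nat.factorial_two, Nat.cast_ofNat] at h
    linarith [hb2 s hs, hpos s hs]

theorem hasSum_laplaceTerm_laplaceMoment
    (hμ : ∀ s, 0 < s → Integrable (fun t : Set.Ioi (0 : ℝ) => rexp (-(s * (t : ℝ)))) μ)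
    {C ε : ℝ} (h : IsRadialProfile (laplaceMoment μ 0) (fun s => -laplaceMoment μ 1 s)
      (laplaceMoment μ 2) C ε) :
    Integrable (fun t : Set.Ioi (0 : ℝ) => thetaLaplacian t) μ ∧
    HasSum (fun p : NonzeroIndex => laplaceTerm (fun s => -laplaceMoment μ 1 s)
      (laplaceMoment μ 2) (quadForm p triangularCoords))
      (∫ t : Set.Ioi (0 : ℝ), thetaLaplacian t ∂μ) := by
  set g : NonzeroIndex → Set.Ioi (0 : ℝ) → ℝ := fun p t =>
    (fun s => (s * t) * (s * t - 2) * rexp (-(s * (t : ℝ)))) (quadForm p triangularCoords)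
  have hQ (p : NonzeroIndex) : 0 < quadForm p triangularCoords :=
    quadForm_pos p.2 triangularCoords_snd_pos
  -- Used with `c = -2` for the terms themselves and with `c = 2` for their majorant `(st)² exp(-st)
  -- + 2 st exp(-st)`, whose integral is at most `(1 + 2) C s^(-1-ε)`.
  have hg (p : NonzeroIndex) (c : ℝ) : Integrable (fun t : Set.Ioi (0 : ℝ) =>
      quadForm p triangularCoords ^ 2 * ((t : ℝ) ^ 2 *
        rexp (-(quadForm p triangularCoords * (t : ℝ)))) +
      c * (quadForm p triangularCoords * ((t : ℝ) ^ 1 *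
        rexp (-(quadForm p triangularCoords * (t : ℝ)))))) μ ∧
      ∫ t : Set.Ioi (0 : ℝ), (quadForm p triangularCoords ^ 2 * ((t : ℝ) ^ 2 *
        rexp (-(quadForm p triangularCoords * (t : ℝ)))) +
      c * (quadForm p triangularCoords * ((t : ℝ) ^ 1 *
        rexp (-(quadForm p triangularCoords * (t : ℝ)))))) ∂μ =
      quadForm p triangularCoords ^ 2 * laplaceMoment μ 2 (quadForm p triangularCoords) +
        c * (quadForm p triangularCoords * laplaceMoment μ 1 (quadForm p triangularCoords)) := by
    have i2 := (integrable_pow_mul_exp hμ 2 (hQ p)).const_mul (quadForm p triangularCoords ^ 2)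
    have i1 := ((integrable_pow_mul_exp hμ 1 (hQ p)).const_mul
      (quadForm p triangularCoords)).const_mul c
    refine ⟨i2.add i1, ?_⟩
    rw [integral_add i2 i1, integral_const_mul, integral_const_mul, integral_const_mul]
    rfl
  have e (p : NonzeroIndex) : g p = fun t : Set.Ioi (0 : ℝ) =>
      quadForm p triangularCoords ^ 2 * ((t : ℝ) ^ 2 *
        rexp (-(quadForm p triangularCoords * (t : ℝ)))) +
      (-2) * (quadForm p triangularCoords * ((t : ℝ) ^ 1 *
        rexp (-(quadForm p triangularCoords * (t : ℝ))))) := by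
    funext t
    simp only [g]
    ring
  have hint (p : NonzeroIndex) : Integrable (g p) μ := by
    rw [e]; exact (hg p (-2)).1
  have hval (p : NonzeroIndex) : ∫ t, g p t ∂μ = laplaceTerm (fun s => -laplaceMoment μ 1 s)
      (laplaceMoment μ 2) (quadForm p triangularCoords) := by
    rw [e, (hg p (-2)).2, laplaceTerm]
    ring
  have hsum : Summable fun p : NonzeroIndex => ∫ t, ‖g p t‖ ∂μ := by
    refine Summable.of_nonneg_of_le (fun p => integral_nonneg fun t => norm_nonneg _)
      (fun p => ?_) ((summable_quadForm_rpow h.eps_pos triangularCoords_snd_pos).mul_left (3 * C))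
    refine (integral_mono (hint p).norm (hg p 2).1 fun t => ?_).trans ?_
    · have ht : 0 < (t : ℝ) := t.2
      have := hQ p
      rw [e]
      refine (norm_add_le _ _).trans (add_le_add ?_ ?_)
      · rw [Real.norm_of_nonneg (by positivity)]
      · rw [norm_mul, Real.norm_of_nonneg (by positivity : (0 : ℝ) ≤ quadForm p triangularCoords *
          ((t : ℝ) ^ 1 * rexp (-(quadForm p triangularCoords * (t : ℝ)))))]
        norm_num
    · rw [(hg p 2).2]
      have h1 := h.bound_deriv _ (hQ p)
      have h2 := h.bound_deriv₂ _ (hQ p)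
      rw [abs_neg, abs_of_nonneg (laplaceMoment_nonneg 1 _)] at h1
      rw [abs_of_nonneg (laplaceMoment_nonneg 2 _)] at h2
      linarith
  have hpt (t : Set.Ioi (0 : ℝ)) : Summable fun p => g p t :=
    (isRadialProfile_exp t.2).summable_laplaceTerm.congr fun p => laplaceTerm_exp t _
  refine ⟨integrable_tsum_of_summable_integral_norm hint hsum hpt, ?_⟩
  have hfin := hasSum_integral_of_summable_integral_norm hint hsum
  simp only [hval] at hfin
  exact hfin

theorem tsum_laplaceTerm_laplaceMoment_pos (hμ0 : μ ≠ 0)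
    (hμ : ∀ s, 0 < s → Integrable (fun t : Set.Ioi (0 : ℝ) => rexp (-(s * (t : ℝ)))) μ)
    {C ε : ℝ} (h : IsRadialProfile (laplaceMoment μ 0) (fun s => -laplaceMoment μ 1 s)
      (laplaceMoment μ 2) C ε) :
    0 < ∑' p : NonzeroIndex, laplaceTerm (fun s => -laplaceMoment μ 1 s)
      (laplaceMoment μ 2) (quadForm p triangularCoords) := by
  obtain ⟨hi, hs⟩ := hasSum_laplaceTerm_laplaceMoment hμ h
  rw [hs.tsum_eq, integral_pos_iff_support_of_nonneg (fun t => (thetaLaplacian_pos t.2).le) hi]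
  have : Function.support (fun t : Set.Ioi (0 : ℝ) => thetaLaplacian t) = Set.univ :=
    Set.eq_univ_of_forall fun t => (thetaLaplacian_pos t.2).ne'
  rw [this]
  exact Measure.measure_univ_pos.2 hμ0

end

/-! ### The second derivative test -/

/-- By the mean value theorem on the segment, the increment is `G (z₀ + s v) v` for some `0 < s <
1`. This differs from `s H v v ≥ c s ‖v‖²` by at most half that lower bound. -/
theorem exists_forall_lt_of_hasFDerivAt_hasFDerivAt {V : Type*} [NormedAddCommGroup V]
    [NormedSpace ℝ V] {E : V → ℝ} {G : V → V →L[ℝ] ℝ} {H : V →L[ℝ] V →L[ℝ] ℝ} {z₀ : V} {c : ℝ}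
    (hc : 0 < c) (hE : ∀ᶠ z in 𝓝 z₀, HasFDerivAt E (G z) z) (hG₀ : G z₀ = 0)
    (hG : HasFDerivAt G H z₀) (hH : ∀ v, c * ‖v‖ ^ 2 ≤ H v v) :
    ∃ δ > 0, ∀ z, ‖z - z₀‖ < δ → z ≠ z₀ → E z₀ < E z := by
  have ho := hG.isLittleO.def (half_pos hc)
  obtain ⟨δ, hδ, hball⟩ := Metric.eventually_nhds_iff.1 (hE.and ho)
  refine ⟨δ, hδ, fun z hz hne => ?_⟩
  set v := z - z₀ with hv
  have hv0 : 0 < ‖v‖ := norm_pos_iff.2 (sub_ne_zero.2 hne)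
  have hnear (s : ℝ) (hs : s ∈ Set.Icc (0 : ℝ) 1) : dist (z₀ + s • v) z₀ < δ := by
    rw [dist_eq_norm, add_sub_cancel_left, norm_smul, Real.norm_of_nonneg hs.1]
    exact (mul_le_of_le_one_left (norm_nonneg v) hs.2).trans_lt hz
  have hderiv (s : ℝ) (hs : s ∈ Set.Icc (0 : ℝ) 1) :
      HasDerivAt (fun s : ℝ => E (z₀ + s • v)) (G (z₀ + s • v) v) s := by
    have h1 : HasDerivAt (fun s : ℝ => z₀ + s • v) v s := by
      simpa using ((hasDerivAt_id s).smul_const v).const_add z₀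
    exact (hball (hnear s hs)).1.comp_hasDerivAt s h1
  obtain ⟨s, hs, he⟩ := exists_hasDerivAt_eq_slope (fun s : ℝ => E (z₀ + s • v))
    (fun s => G (z₀ + s • v) v) zero_lt_one
    (fun s hs => (hderiv s hs).continuousAt.continuousWithinAt)
    (fun s hs => hderiv s (Set.Ioo_subset_Icc_self hs))
  have hb := (hball (hnear s (Set.Ioo_subset_Icc_self hs))).2
  rw [hG₀, sub_zero, add_sub_cancel_left] at hb
  have hb' := (ContinuousLinearMap.le_opNorm (G (z₀ + s • v) - H (s • v)) v).trans
    (mul_le_mul_of_nonneg_right hb (norm_nonneg v))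
  rw [norm_smul, Real.norm_of_nonneg hs.1.le, sub_apply, map_smul, smul_apply,
    smul_eq_mul, Real.norm_eq_abs] at hb'
  have h2 := mul_le_mul_of_nonneg_left (hH v) hs.1.le
  have h3 : 0 < s * (c * ‖v‖ ^ 2) := mul_pos hs.1 (by positivity)
  have h4 : 0 < G (z₀ + s • v) v := by
    have := (abs_le.1 hb').1
    nlinarith
  rw [he] at h4
  simp only [one_smul, zero_smul, add_zero, sub_zero, div_one, hv, add_sub_cancel] at h4
  linarith

/-! ### Lattices and their coordinates -/

/-- The lattice vector with integer coordinates `p` in the lattice `L(x, y)`. -/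
noncomputable def latticePoint (z : ℝ × ℝ) (p : ℤ × ℤ) : Plane :=
  p.1 • !₂[1 / √z.2, 0] + p.2 • !₂[z.1 / √z.2, √z.2]

theorem mem_latticeOf {z : ℝ × ℝ} {x : Plane} :
    x ∈ latticeOf z ↔ ∃ p, latticePoint z p = x := by
  rw [latticeOf, Submodule.mem_span_pair, Prod.exists]
  rfl

theorem norm_sq_latticePoint {z : ℝ × ℝ} (hz : 0 < z.2) (p : ℤ × ℤ) :
    ‖latticePoint z p‖ ^ 2 = quadForm p z := by
  have h : √z.2 ^ 2 = z.2 := Real.sq_sqrt hz.le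
  have h0 : √z.2 ≠ 0 := (Real.sqrt_pos.2 hz).ne'
  have hi : z.2⁻¹ = (√z.2)⁻¹ ^ 2 := by rw [inv_pow, h]
  rw [EuclideanSpace.real_norm_sq_eq, Fin.sum_univ_two, quadForm, hi]
  simp [latticePoint]
  field_simp
  rw [show √z.2 ^ 4 = (√z.2 ^ 2) ^ 2 by ring, h]
  ring

theorem latticePoint_eq_zero_iff {z : ℝ × ℝ} (hz : 0 < z.2) {p : ℤ × ℤ} :
    latticePoint z p = 0 ↔ p = 0 := by
  constructor
  · intro h
    by_contra hp
    have := quadForm_pos hp hz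
    rw [← norm_sq_latticePoint hz, h] at this
    simp at this
  · rintro rfl
    simp [latticePoint]

theorem latticePoint_injective {z : ℝ × ℝ} (hz : 0 < z.2) :
    Function.Injective (latticePoint z) := fun p q h => by
  have e : latticePoint z (p - q) = latticePoint z p - latticePoint z q := by
    simp only [latticePoint, Prod.fst_sub, Prod.snd_sub, sub_smul]
    abel
  rw [h, sub_self, latticePoint_eq_zero_iff hz] at e
  exact sub_eq_zero.1 e

/-- The nonzero vectors of a lattice are indexed by the nonzero integer vectors. -/
noncomputable def latticeEquiv {z : ℝ × ℝ} (hz : 0 < z.2) :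
    NonzeroIndex ≃ ((latticeOf z : Set Plane) \ {0} : Set Plane) :=
  Equiv.ofBijective (fun p => ⟨latticePoint z p, mem_latticeOf.2 ⟨p, rfl⟩,
    fun h => p.2 ((latticePoint_eq_zero_iff hz).1 h)⟩)
    ⟨fun _ _ h => Subtype.ext (latticePoint_injective hz (congrArg Subtype.val h)),
      fun ⟨x, hx, hx0⟩ => by
        obtain ⟨p, rfl⟩ := mem_latticeOf.1 hx
        exact ⟨⟨p, fun hp => hx0 ((latticePoint_eq_zero_iff hz).2 hp)⟩, rfl⟩⟩

@[simp] theorem coe_latticeEquiv {z : ℝ × ℝ} (hz : 0 < z.2) (p : NonzeroIndex) :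
    (latticeEquiv hz p : Plane) = latticePoint z p := rfl

theorem summable_lattice_iff {F : ℝ → ℝ} {f : Plane → ℝ} (hf : ∀ x, f x = F (‖x‖ ^ 2))
    {z : ℝ × ℝ} (hz : 0 < z.2) :
    Summable (fun p : ((latticeOf z : Set Plane) \ {0} : Set Plane) => f p) ↔
      Summable fun p : NonzeroIndex => F (quadForm p z) := by
  rw [← (latticeEquiv hz).summable_iff]
  simp only [Function.comp_def, coe_latticeEquiv, hf, norm_sq_latticePoint hz]

theorem inCoords_pointEnergy {F : ℝ → ℝ} {f : Plane → ℝ} (hf : ∀ x, f x = F (‖x‖ ^ 2))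
    {z : ℝ × ℝ} (hz : 0 < z.2) : inCoords (pointEnergy f) z = radialSum F z := by
  rw [inCoords, pointEnergy, radialSum, ← (latticeEquiv hz).tsum_eq]
  simp only [coe_latticeEquiv, hf, norm_sq_latticePoint hz]

/-- The vector `(1/√y, 0)` lies in `Λ`, so `1/y ≥ 2/√3`, that is `y ≤ √3/2`. Together with `0 ≤ x ≤
1/2` and `x² + y² ≥ 1` this leaves a single point. -/
theorem eq_triangularCoords_of_latticeOf_eq {z : ℝ × ℝ} (hz : z ∈ fundDomain)
    (h : latticeOf z = triangularLattice) : z = triangularCoords := by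
  obtain ⟨⟨hx0, hx1⟩, hy, h1⟩ := hz
  have hmem : latticePoint z (1, 0) ∈ latticeOf triangularCoords := by
    rw [latticeOf_triangularCoords, ← h]
    exact mem_latticeOf.2 ⟨_, rfl⟩
  obtain ⟨p, hp⟩ := mem_latticeOf.1 hmem
  have hp0 : p ≠ 0 := by
    rintro rfl
    rw [(latticePoint_eq_zero_iff triangularCoords_snd_pos).2 rfl, eq_comm,
      latticePoint_eq_zero_iff hy] at hp
    simp at hp
  have hle := two_div_three_mul_sqrt_le_quadForm ⟨p, hp0⟩
  dsimp only at hle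
  rw [← norm_sq_latticePoint triangularCoords_snd_pos, hp, norm_sq_latticePoint hy] at hle
  have h3 : √3 * √3 = 3 := Real.mul_self_sqrt (by norm_num)
  have hs : 0 < √3 := by positivity
  have hq : quadForm (1, 0) z * z.2 = 1 := by
    simp [quadForm, hy.ne']
  have hle' := mul_le_mul_of_nonneg_right hle hy.le
  rw [hq] at hle'
  have hy1 : z.2 ≤ √3 / 2 := by nlinarith
  have hy2 : √3 / 2 ≤ z.2 := by nlinarith
  have hy3 : z.2 = √3 / 2 := le_antisymm hy1 hy2
  have hx : z.1 = 1 / 2 := by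
    rw [hy3] at h1
    nlinarith
  exact Prod.ext hx hy3

theorem norm_sub_lt_of_coordDist_lt {w : ℝ × ℝ} (hw : w ∈ fundDomain) {R : ℝ} (hR : R ≤ 1 / 32)
    (h : coordDist triangularCoords w < R) : ‖w - triangularCoords‖ < R := by
  obtain ⟨⟨hx0, hx1⟩, hy, h1⟩ := hw
  have hR0 : 0 < R := (Real.sqrt_nonneg _).trans_lt h
  rw [coordDist, Real.sqrt_lt' hR0] at h
  obtain ⟨k, hk⟩ := exists_lt_of_ciInf_lt h
  simp only [triangularCoords, sq_abs] at hk
  have hxk := abs_lt_of_sq_lt_sq (by linarith [sq_nonneg (√3 / 2 - w.2)] :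
    (1 / 2 - w.1 - 1 / 2 * (k : ℝ)) ^ 2 < R ^ 2) hR0.le
  have hyk := abs_lt_of_sq_lt_sq (by linarith [sq_nonneg (1 / 2 - w.1 - 1 / 2 * (k : ℝ))] :
    (√3 / 2 - w.2) ^ 2 < R ^ 2) hR0.le
  rw [abs_lt] at hxk hyk
  have h3 : √3 < 1.74 := by
    rw [Real.sqrt_lt' (by norm_num)]; norm_num
  have hw2 : w.2 < 0.902 := by linarith
  -- With `y < 0.902`, the constraint `x² + y² ≥ 1` keeps `x` away from `0`. This excludes `k ≥ 1`,
  -- the identification of `x = 1/2` with `x = 0`; `k ≤ -1` would need `x` near `1` or beyond.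
  have hw1 : 0.42 < w.1 := by nlinarith
  have hk0 : k = 0 := by
    have hk1 : k < 1 := by
      by_contra! hge
      have : (1 : ℝ) ≤ k := by exact_mod_cast hge
      linarith
    have hk2 : -1 < k := by
      by_contra! hge
      have : (k : ℝ) ≤ -1 := by exact_mod_cast hge
      linarith
    omega
  subst hk0
  simp only [Int.cast_zero, mul_zero, sub_zero] at hxk
  rw [Prod.norm_def, max_lt_iff, Real.norm_eq_abs, Real.norm_eq_abs, abs_lt, abs_lt]
  simp only [triangularCoords, Prod.fst_sub, Prod.snd_sub]
  refine ⟨⟨?_, ?_⟩, ?_, ?_⟩ <;> linarith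

theorem isStrictLocalMinimizer_triangularLattice {E : Submodule ℤ Plane → ℝ} {δ : ℝ} (hδ : 0 < δ)
    (h : ∀ z : ℝ × ℝ, ‖z - triangularCoords‖ < δ → z ≠ triangularCoords →
      inCoords E triangularCoords < inCoords E z) :
    IsStrictLocalMinimizer E triangularLattice := by
  refine ⟨⟨_, triangularCoords_mem, latticeOf_triangularCoords⟩, min δ (1 / 32), by positivity, ?_⟩
  rintro M ⟨z, hz, w, hw, hzL, rfl, hd⟩ hne
  -- The ball allows any coordinates of `Λ` in the fundamental domain as centre; uniqueness pins
  -- them down.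
  rw [eq_triangularCoords_of_latticeOf_eq hz hzL] at hd
  have hw0 : w ≠ triangularCoords := by
    rintro rfl
    exact hne latticeOf_triangularCoords
  have := h w ((norm_sub_lt_of_coordDist_lt hw (min_le_right _ _) hd).trans_le (min_le_left _ _)) hw0
  rwa [inCoords, inCoords, latticeOf_triangularCoords] at this

/-! ### The main theorem -/

theorem exists_laplaceMoment_of_mem_potentialClass {f : Plane → ℝ} (hf : f ∈ PotentialClass)
    (hf0 : f ≠ 0) : ∃ μ : Measure (Set.Ioi (0 : ℝ)), μ ≠ 0 ∧
      (∀ s, 0 < s → Integrable (fun t : Set.Ioi (0 : ℝ) => rexp (-(s * (t : ℝ)))) μ) ∧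
      (∀ x, f x = laplaceMoment μ 0 (‖x‖ ^ 2)) ∧
      ∃ C ε, IsRadialProfile (laplaceMoment μ 0) (fun s => -laplaceMoment μ 1 s)
        (laplaceMoment μ 2) C ε := by
  obtain ⟨⟨C, hC, η, hη, hdec⟩, μ, -, hμ⟩ := hf
  have hnorm (s : ℝ) (hs : 0 < s) : ∃ x : Plane, ‖x‖ ^ 2 = s := by
    obtain ⟨x, hx⟩ := exists_norm_eq Plane (Real.sqrt_nonneg s)
    exact ⟨x, by rw [hx, Real.sq_sqrt hs.le]⟩
  have hfx (x : Plane) : f x = laplaceMoment μ 0 (‖x‖ ^ 2) := by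
    rw [(hμ x).2, laplaceMoment]
    simp
  have hint (s : ℝ) (hs : 0 < s) :
      Integrable (fun t : Set.Ioi (0 : ℝ) => rexp (-(s * (t : ℝ)))) μ := by
    obtain ⟨x, rfl⟩ := hnorm s hs
    exact (hμ x).1
  -- The profile is a function of `‖x‖²`, so the exponent `2 + η` becomes `1 + η / 2`.
  refine ⟨μ, ?_, hint, hfx, _, _, isRadialProfile_laplaceMoment hint (C := C) (half_pos hη) ?_⟩
  · rintro rfl
    refine hf0 (funext fun x => ?_)
    rw [(hμ x).2]
    simp
  · intro s hs
    obtain ⟨x, rfl⟩ := hnorm s hs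
    have hx : 0 < ‖x‖ := by
      rcases (norm_nonneg x).eq_or_lt with h | h
      · rw [← h] at hs; simp at hs
      · exact h
    rw [← hfx]
    calc f x ≤ |f x| + ‖𝓕 (fun v : Plane => (f v : ℂ)) x‖ :=
          (le_abs_self _).trans (le_add_of_nonneg_right (norm_nonneg _))
      _ ≤ C / (1 + ‖x‖) ^ (2 + η) := hdec x
      _ ≤ C / ‖x‖ ^ (2 + η) := by gcongr; linarith
      _ = C * (‖x‖ ^ 2) ^ (-(1 + η / 2)) := by
          rw [← Real.rpow_natCast ‖x‖ 2, ← Real.rpow_mul hx.le, div_eq_mul_inv,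
            ← Real.rpow_neg hx.le]
          congr 2
          push_cast
          ring

theorem mainTheorem4 (f : Plane → ℝ) (hf : f ∈ PotentialClass) (hf0 : f ≠ 0) :
    (∀ z : ℝ × ℝ, 0 < z.2 →
      Summable (fun p : ((latticeOf z : Set Plane) \ {0} : Set Plane) => f p)) ∧
    IsStrictLocalMinimizer (pointEnergy f) triangularLattice ∧
    ContDiffAt ℝ 2 (inCoords (pointEnergy f)) triangularCoords ∧
    (latticeHessian (pointEnergy f) triangularCoords).PosDef := by
  obtain ⟨μ, hμ0, hμ, hfx, C, ε, h⟩ := exists_laplaceMoment_of_mem_potentialClass hf hf0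
  have hpos := tsum_laplaceTerm_laplaceMoment_pos hμ0 hμ h
  have hH := h.radialHess_triangularCoords
  set S := ∑' p : NonzeroIndex, laplaceTerm (fun s => -laplaceMoment μ 1 s)
      (laplaceMoment μ 2) (quadForm p triangularCoords)
  have hopen : {z : ℝ × ℝ | 0 < z.2} ∈ 𝓝 triangularCoords :=
    (isOpen_lt continuous_const continuous_snd).mem_nhds triangularCoords_snd_pos
  have heq : inCoords (pointEnergy f) =ᶠ[𝓝 triangularCoords] radialSum (laplaceMoment μ 0) := by
    filter_upwards [hopen] with z hz using inCoords_pointEnergy hfx hz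
  refine ⟨fun z hz => (summable_lattice_iff hfx hz).2 (h.summable hz), ?_,
    (h.contDiffOn_radialSum.contDiffAt hopen).congr_of_eventuallyEq heq, ?_⟩
  · have hE : ∀ᶠ z in 𝓝 triangularCoords, HasFDerivAt (inCoords (pointEnergy f))
        (radialGrad (fun s => -laplaceMoment μ 1 s) z) z := by
      filter_upwards [heq.eventuallyEq_nhds, hopen] with z hz hz0
      exact (h.hasFDerivAt_radialSum hz0).congr_of_eventuallyEq hz
    obtain ⟨δ, hδ, hlt⟩ := exists_forall_lt_of_hasFDerivAt_hasFDerivAt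
      (c := 2 / 3 * S) (by positivity) hE h.radialGrad_triangularCoords
      (h.hasFDerivAt_radialGrad triangularCoords_snd_pos) fun v => by
        rw [hH]
        refine mul_le_mul_of_nonneg_left ?_ (by positivity)
        -- The norm on `ℝ × ℝ` is the sup norm, whose square is at most `v.1² + v.2²`.
        rw [Prod.norm_def]
        rcases max_choice ‖v.1‖ ‖v.2‖ with e | e <;> rw [e, Real.norm_eq_abs, sq_abs] <;>
          nlinarith [sq_nonneg v.1, sq_nonneg v.2]
    exact isStrictLocalMinimizer_triangularLattice hδ hlt
  · have e : latticeHessian (pointEnergy f) triangularCoords =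
        (2 / 3 * S) • (1 : Matrix (Fin 2) (Fin 2) ℝ) := by
      have e1 : fderiv ℝ (fderiv ℝ (inCoords (pointEnergy f))) triangularCoords =
          radialHess (fun s => -laplaceMoment μ 1 s) (laplaceMoment μ 2) triangularCoords :=
        heq.fderiv.fderiv_eq.trans (h.fderiv_fderiv_radialSum triangularCoords_snd_pos)
      ext i j
      simp only [latticeHessian, e1, Matrix.of_apply, hH]
      fin_cases i <;> fin_cases j <;> simp
    rw [e]
    exact Matrix.PosDef.one.smul (by positivity)
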